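/- **Setting.** Identify the circle $\mathbb T^1=\mathbb R/\mathbb Z$ with $[0,1)$ and let $m$ be Lebesgue measure on it. Let $0<\alpha\le 1$, $f:[0,1)\to[0,1)$ and $\tau:[0,1)\to\mathbb R$. Let $\{O_i\}_{i\in I}$ be a countable family of pairwise disjoint nonempty open intervals in $[0,1]$ that covers $[0,1)$ up to a countable set (the joint partition of $f$ and $\tau$), such that on each $O_i$ the map $f$ is strictly monotone and $C^1$ with $\alpha$-Hölder derivative (hence $C^{1+\alpha}$ up to the closure of $O_i$), and $\tau$ is $C^1$. For $n\ge1$ let $\mathcal H^n$ be the set of inverse branches $h:f^n(O_h)\to O_h$ of $f^n$, where $O_h$ runs over the nonempty sets $\{x: f^k(x)\in O_{i_k},\ 0\le k<n\}$, and let $\tau_n=\sum_{j=0}^{n-1}\tau\circ f^j$. Assume: 1. (expansion) there is $\lambda>\ln 2$ with $|(f^n)'|\ge e^{\lambda n}$ on every $O_h$, $h\in\mathcal H^n$, $n\ge1$; 2. (distortion) there is $D\ge0$ with $|h'(x)|/|h'(y)|\le e^{D|x-y|^\alpha}$ for all $n\ge1$, $h\in\mathcal H^n$, $x,y\in f^n(O_h)$;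 3. (summability) $\sum_{h\in\mathcal H^n}\sup_{f^n(O_h)}|h'|<\infty$ for every $n\ge1$; 4. (covering) for every $n\ge1$ there is $N$ such that for every $h\in\mathcal H^n$ the set $f^N(O_h)$ is all of $[0,1)$ up to a countable set; 5. ($\tau$ is not Lipschitz-cohomologous to a piecewise constant function) there is no Lipschitz function $\phi:[0,1)\to\mathbb R$ for which $\tau-\phi\circ f+\phi$ is constant on each $O_i$; 6. there is $C_\tau$ with $|(\tau_n\circ h)'|\le C_\tau$ on $f^n(O_h)$ for all $n\ge1$, $h\in\mathcal H^n$. For $b\in\mathbb R$ let $$\mathcal L_b g=\sum_{h\in\mathcal H^1}e^{ib\,\tau\circ h}\; g\circ h\;|h'|\;\mathbf 1_{f(O_h)} .$$ Let $C^\alpha=C^\alpha(\mathbb T^1)$ be the space of complex $\alpha$-Hölder functions on the circle $\mathbb R/\mathbb Z$ with norm $\|g\|_{C^\alpha}=|g|_\alpha+\sup|g|$. Let $\mathcal B\subset L^1(m)$ be a complex Banach space with $\|g\|_{L^1}\le\|g\|_{\mathcal B}$ for $g\in\mathcal B$; with $C^\alpha\subset\mathcal B$ and $\|g\|_{\mathcal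 B}\le\|g\|_{C^\alpha}$ for $g\in C^\alpha$; and such that for every $g\in\mathcal B$ and $\varepsilon>0$ there is $g_\varepsilon\in C^\alpha$ with $\|g-g_\varepsilon\|_{L^1}\le\varepsilon\|g\|_{\mathcal B}$ and $\|g_\varepsilon\|_{C^\alpha}\le\varepsilon^{-(1+\alpha^{-1})}\|g\|_{\mathcal B}$. Assume finally that $f$ preserves a probability measure $\mu\ll m$ whose density belongs to $\mathcal B$ and that $(f,\mu)$ is mixing. **Proposition.** Let $b\in\mathbb R$, $b\ne0$, be such that $\mathcal L_b$ is a bounded operator $\mathcal B\to\mathcal B$ with spectral radius $\le1$ and essential spectral radius $<1$ (the latter being the least $r\ge 0$ such that every point of the spectrum of modulus $>r$ is an isolated eigenvalue of finite algebraic multiplicity). Then there are constants $C$ and $r>0$, both depending on $b$, such that for every $n\in\mathbb N$ $$\|\mathcal L_b^n\|_{\mathcal B}\le C e^{-rn}.$$ In particular this holds for every $b\neq 0$ if $\mathcal L_b$ has these properties for every $b$. -/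

import Mathlib

open MeasureTheory Set Filter Topology
open scoped NNReal ENNReal

noncomputable section

namespace SkewProduct

/-! ### Essential spectral radius of a bounded operator -/

section EssentialSpectrum

variable {E : Type*} [NormedAddCommGroup E] [NormedSpace ℂ E]

/-- A Browder operator: a Fredholm operator with finite ascent and finite descent. For `z` in the
spectrum of `T`, the operator `z - T` is Browder exactly when `z` is an isolated point of the
spectrum and an eigenvalue of finite algebraic multiplicity (finite rank Riesz projection). -/
structure IsBrowder (T : E →L[ℂ] E) : Prop where
  isFredholm : T.IsFredholm
  finite_ascent : ∃ k : ℕ, (T ^ k).ker = (T ^ (k + 1)).ker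
  finite_descent : ∃ k : ℕ, (T ^ k).range = (T ^ (k + 1)).range

/-- The (Browder) essential spectrum: the spectrum without the isolated eigenvalues of finite
algebraic multiplicity. -/
def essentialSpectrum (T : E →L[ℂ] E) : Set ℂ :=
  {z | ¬ IsBrowder (z • (1 : E →L[ℂ] E) - T)}

/-- The essential spectral radius: the least `r` such that the spectrum outside the closed disc of
radius `r` consists of isolated eigenvalues of finite algebraic multiplicity. -/
def essentialSpectralRadius (T : E →L[ℂ] E) : ℝ≥0∞ :=
  ⨆ z ∈ essentialSpectrum T, (‖z‖₊ : ℝ≥0∞)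

end EssentialSpectrum

/-! ### The dynamical setting

The circle is `[0, 1)`. The base map `f` and the fibre function `τ` are given by real functions of
which only the values on `[0, 1)` matter. The family `O` lists the open intervals of the
(joint) partition of `f` and `τ`. -/

variable {ι : Type*}

/-- The partition element of `f^n` that belongs to the itinerary `w`. The nonempty ones are the
intervals `O_h` with `h` an inverse branch of `f^n`. -/
def cylinder (f : ℝ → ℝ) (O : ι → Set ℝ) {n : ℕ} (w : Fin n → ι) : Set ℝ :=
  {x | ∀ k : Fin n, f^[(k : ℕ)] x ∈ O (w k)}

/-- The image `f^n(O_h)`, which is the domain of the inverse branch `h` of `f^n`. -/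
def branchDomain (f : ℝ → ℝ) (O : ι → Set ℝ) {n : ℕ} (w : Fin n → ι) : Set ℝ :=
  f^[n] '' cylinder f O w

/-- The inverse branch `h : f^n(O_h) → O_h` of `f^n`. -/
def inverseBranch (f : ℝ → ℝ) (O : ι → Set ℝ) {n : ℕ} (w : Fin n → ι) : ℝ → ℝ :=
  Function.invFunOn f^[n] (cylinder f O w)

/-- The standing assumptions on the skew product `(x, y) ↦ (f x, y + τ x)`. -/
structure IsExpandingSkewProduct (α : ℝ≥0) (f τ : ℝ → ℝ) (O : ι → Set ℝ) : Prop where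
  mapsTo : MapsTo f (Ico 0 1) (Ico 0 1)
  -- a partition into open intervals, modulo a countable set
  interval : ∀ i, ∃ a c : ℝ, 0 ≤ a ∧ a < c ∧ c ≤ 1 ∧ O i = Ioo a c
  disjoint : Pairwise fun i j => Disjoint (O i) (O j)
  cover : (Ico (0 : ℝ) 1 \ ⋃ i, O i).Countable
  -- `f` is monotone and `C^{1+α}` on each interval, up to its closure
  monotone : ∀ i, StrictMonoOn f (O i) ∨ StrictAntiOn f (O i)
  contDiffOn : ∀ i, ContDiffOn ℝ 1 f (O i)
  holder_deriv : ∀ i, ∃ K : ℝ≥0, HolderOnWith K α (deriv f) (O i)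
  expanding : ∃ lam : ℝ, Real.log 2 < lam ∧ ∀ n : ℕ, 1 ≤ n → ∀ w : Fin n → ι,
    ∀ x ∈ cylinder f O w, Real.exp (lam * n) ≤ |deriv f^[n] x|
  distortion : ∃ D : ℝ, 0 ≤ D ∧ ∀ n : ℕ, 1 ≤ n → ∀ w : Fin n → ι,
    ∀ x ∈ branchDomain f O w, ∀ y ∈ branchDomain f O w,
      |deriv (inverseBranch f O w) x| / |deriv (inverseBranch f O w) y|
        ≤ Real.exp (D * |x - y| ^ (α : ℝ))
  summability : ∀ n : ℕ, 1 ≤ n →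
    ∑' w : Fin n → ι, ⨆ x ∈ branchDomain f O w, ‖deriv (inverseBranch f O w) x‖ₑ < ⊤
  -- covering, modulo a countable set (the values of `f` at endpoints are irrelevant)
  covering : ∀ n : ℕ, 1 ≤ n → ∃ N : ℕ, ∀ w : Fin n → ι, (cylinder f O w).Nonempty →
    (Ico (0 : ℝ) 1 \ f^[N] '' cylinder f O w).Countable
  contDiffOn_fibre : ∀ i, ContDiffOn ℝ 1 τ (O i)
  -- `τ` is not Lipschitz-cohomologous to a piecewise constant function
  not_cohomologous : ¬ ∃ φ : ℝ → ℝ, (∃ K : ℝ≥0, LipschitzOnWith K φ (Ico 0 1)) ∧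
    ∀ i, ∃ c : ℝ, ∀ x ∈ O i, τ x = φ (f x) - φ x + c
  fibre_regularity : ∃ C : ℝ, ∀ n : ℕ, 1 ≤ n → ∀ w : Fin n → ι, ∀ x ∈ branchDomain f O w,
    |deriv (fun y => birkhoffSum f τ n (inverseBranch f O w y)) x| ≤ C

/-! ### Function spaces and the weighted transfer operator -/

/-- Lebesgue measure on the circle `[0, 1)`. -/
def circleMeasure : Measure ℝ := volume.restrict (Ico 0 1)

/-- The norm of `C^α` of the circle; infinite for functions that are not in `C^α`. -/
def cAlphaNorm (α : ℝ≥0) (g : UnitAddCircle → ℂ) : ℝ≥0∞ :=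
  eHolderNorm α g + ⨆ x, ‖g x‖ₑ

/-- The weighted transfer operator `∑_h e^{ibτ∘h} · g∘h · |h'| · 1_{f(O_h)}`, the sum being over the
inverse branches `h` of `f`. For integrable `g` the series converges absolutely almost
everywhere. -/
def transfer (f τ : ℝ → ℝ) (O : ι → Set ℝ) (b : ℝ) (g : ℝ → ℂ) (x : ℝ) : ℂ :=
  ∑' i, (f '' O i).indicator (fun y =>
    Complex.exp (Complex.I * b * τ (Function.invFunOn f (O i) y)) *
      g (Function.invFunOn f (O i) y) * |deriv (Function.invFunOn f (O i)) y|) x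

/-- The conditions relating a Banach space `B`, included in `L¹` of the circle by `J`, to `L¹` and
`C^α`. -/
structure IsAdapted (α : ℝ≥0) {B : Type*} [NormedAddCommGroup B] [NormedSpace ℂ B]
    (J : B →ₗ[ℂ] Lp ℂ 1 circleMeasure) : Prop where
  injective : Function.Injective J
  norm_le : ∀ p : B, ‖J p‖ ≤ ‖p‖
  contains_cAlpha : ∀ g : UnitAddCircle → ℂ, cAlphaNorm α g < ⊤ →
    ∃ p : B, (J p : ℝ → ℂ) =ᵐ[circleMeasure] (fun x : ℝ => g x) ∧ ‖p‖ₑ ≤ cAlphaNorm α g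
  approx : ∀ p : B, ∀ ε : ℝ, 0 < ε → ∃ q : UnitAddCircle → ℂ,
    eLpNorm (fun x : ℝ => J p x - q x) 1 circleMeasure ≤ ENNReal.ofReal (‖p‖ * ε) ∧
    cAlphaNorm α q ≤ ENNReal.ofReal (‖p‖ * ε ^ (-(1 + (α : ℝ)⁻¹)))

/-- The bounded operator `L` on `B` is the transfer operator with weight `e^{ibτ}`. -/
def IsTransferOn (f τ : ℝ → ℝ) (O : ι → Set ℝ) (b : ℝ) {B : Type*} [NormedAddCommGroup B]
    [NormedSpace ℂ B] (J : B →ₗ[ℂ] Lp ℂ 1 circleMeasure) (L : B →L[ℂ] B) : Prop :=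
  ∀ p : B, (J (L p) : ℝ → ℂ) =ᵐ[circleMeasure] transfer f τ O b (J p)

/-- `μ` is an `f`-invariant and mixing probability measure, absolutely continuous with respect to
Lebesgue measure on the circle, whose density belongs to `B`. -/
structure IsMixingInvariant (f : ℝ → ℝ) {B : Type*} [NormedAddCommGroup B] [NormedSpace ℂ B]
    (J : B →ₗ[ℂ] Lp ℂ 1 circleMeasure) (μ : Measure ℝ) : Prop where
  isProbabilityMeasure : IsProbabilityMeasure μ
  absolutelyContinuous : μ ≪ circleMeasure
  density_mem : ∃ p : B,
    (J p : ℝ → ℂ) =ᵐ[circleMeasure] fun x => ((μ.rnDeriv circleMeasure x).toReal : ℂ)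
  invariant : Measure.map f μ = μ
  mixing : ∀ A A' : Set ℝ, MeasurableSet A → MeasurableSet A' →
    Tendsto (fun n : ℕ => μ (A ∩ f^[n] ⁻¹' A')) atTop (𝓝 (μ A * μ A'))

end SkewProduct

end

/-!
Suppose that `L g = z g` with `|z| = 1` and `g ≠ 0`. The transfer operator preserves integrals of
nonnegative functions, so there is equality almost everywhere in the triangle inequality
`|g| = |L g| ≤ ∑_h |g ∘ h| |h'|`. Hence the measure `|g| m` is `f`-invariant, and all terms of the
sum `L g` have the same argument: the phase `u = g / |g|` satisfies `e^{ibτ} u = z u ∘ f`.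

Approximating `g` by Hölder functions shows that the points which `f` maps to within `t` of the
ends of the intervals `f(O_i)` have `|g| m`-measure at most `C t^κ`. The inverse branches contract
exponentially, so by invariance of `|g| m` and a geometric series there is `ρ > 0` such that, for
every `n`, most points have a cylinder whose image under `f^n` contains the `ρ`-ball around their
`f^n`-image; hence a set of positive measure has this property for infinitely many `n`. At a
Lebesgue point of `u` in this set, bounded distortion turns these images into an interval on which
`u` is the limit of the uniformly Lipschitz functions `z^{-n} e^{ibτ_n ∘ h}`, up to constants. The
covering property carries the Lipschitz continuity to a neighbourhood of almost every point.

The derivative of `arg u` is then a bounded function, and its primitive `φ` divided by `b` makes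
`τ - φ ∘ f + φ` locally constant, which the assumptions on `τ` exclude. So `L` has no eigenvalue on
the unit circle, and its essential spectral radius being less than one, its spectral radius is too.
-/

noncomputable section

namespace SkewProduct

/-! ### Quasi-compact operators -/

theorem surjective_of_injective_of_range_iterate_eq {X : Type*} {f : X → X} {k : ℕ}
    (hf : Function.Injective f) (hrange : range f^[k] = range f^[k + 1]) :
    Function.Surjective f := by
  intro x
  obtain ⟨y, hy⟩ : f^[k] x ∈ range f^[k + 1] := hrange ▸ mem_range_self x
  exact ⟨y, hf.iterate k (by rwa [Function.iterate_succ_apply] at hy)⟩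

theorem exists_norm_pow_le_exp_of_spectralRadius_lt_one {A : Type*} [NormedRing A]
    [NormedAlgebra ℂ A] [CompleteSpace A] {a : A} (ha : spectralRadius ℂ a < 1) :
    ∃ C r : ℝ, 0 < r ∧ ∀ n : ℕ, ‖a ^ n‖ ≤ C * Real.exp (-r * n) := by
  obtain ⟨s, has, hs1⟩ := ENNReal.lt_iff_exists_nnreal_btwn.1 ha
  have hs0 : (0 : ℝ) < s := by exact_mod_cast (zero_le (a := spectralRadius ℂ a)).trans_lt has
  have hexp (n : ℕ) : Real.exp (-(-Real.log s) * n) = (s : ℝ) ^ n := by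
    rw [neg_neg, mul_comm, Real.exp_nat_mul, Real.exp_log hs0]
  have hO : (fun n : ℕ => a ^ n) =O[atTop] fun n : ℕ => (s : ℝ) ^ n := by
    refine Asymptotics.IsBigO.of_norm_eventuallyLE ?_
    have hroot := spectrum.pow_nnnorm_pow_one_div_tendsto_nhds_spectralRadius a
    filter_upwards [hroot.eventually (gt_mem_nhds has), eventually_ge_atTop 1] with n hn hn1
    have hpow := ENNReal.rpow_le_rpow hn.le (Nat.cast_nonneg (α := ℝ) n)
    rw [← ENNReal.rpow_mul, one_div_mul_cancel (by positivity), ENNReal.rpow_one,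
      ENNReal.rpow_natCast] at hpow
    exact_mod_cast hpow
  obtain ⟨C, -, hC⟩ := Asymptotics.bound_of_isBigO_nat_atTop hO
  refine ⟨C, -Real.log s, neg_pos.2 (Real.log_neg hs0 (by exact_mod_cast hs1)), fun n => ?_⟩
  rw [hexp]
  simpa using hC (x := n) (by positivity)

section

variable {E : Type*} [NormedAddCommGroup E] [NormedSpace ℂ E] [CompleteSpace E]

theorem IsBrowder.isUnit_of_injective {T : E →L[ℂ] E} (hT : IsBrowder T)
    (hinj : Function.Injective T) : IsUnit T := by
  obtain ⟨k, hk⟩ := hT.finite_descent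
  refine ContinuousLinearMap.isUnit_iff_bijective.2
    ⟨hinj, surjective_of_injective_of_range_iterate_eq (k := k) hinj ?_⟩
  simpa only [LinearMap.coe_range, ContinuousLinearMap.coe_coe, FunLike.coe_pow_eq_iterate]
    using congrArg (SetLike.coe (B := E)) hk

theorem hasEigenvalue_of_mem_spectrum {L : E →L[ℂ] E} {z : ℂ} (hz : z ∈ spectrum ℂ L)
    (hess : essentialSpectralRadius L < ‖z‖₊) :
    Module.End.HasEigenvalue (L : E →ₗ[ℂ] E) z := by
  have hbrowder : IsBrowder (z • (1 : E →L[ℂ] E) - L) := by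
    by_contra h
    exact hess.not_ge (le_iSup₂ (f := fun z (_ : z ∈ essentialSpectrum L) => (‖z‖₊ : ℝ≥0∞)) z h)
  by_contra hcon
  rw [Module.End.hasEigenvalue_iff, not_not, Submodule.eq_bot_iff] at hcon
  refine hz (spectrum.mem_resolventSet_iff.2 ?_)
  rw [Algebra.algebraMap_eq_smul_one]
  refine hbrowder.isUnit_of_injective ((injective_iff_map_eq_zero _).2 fun p hp => hcon p ?_)
  exact Module.End.mem_eigenspace_iff.2 (sub_eq_zero.1 (by simpa using hp)).symm

theorem exists_norm_pow_le_exp_of_forall_not_hasEigenvalue {L : E →L[ℂ] E}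
    (hL : spectralRadius ℂ L ≤ 1) (hess : essentialSpectralRadius L < 1)
    (hev : ∀ z : ℂ, ‖z‖ = 1 → ¬ Module.End.HasEigenvalue (L : E →ₗ[ℂ] E) z) :
    ∃ C r : ℝ, 0 < r ∧ ∀ n : ℕ, ‖L ^ n‖ ≤ C * Real.exp (-r * n) := by
  refine exists_norm_pow_le_exp_of_spectralRadius_lt_one (hL.lt_of_ne fun heq => ?_)
  rcases subsingleton_or_nontrivial E with hE | hE
  · rw [Subsingleton.elim L 0, spectrum.spectralRadius_zero] at heq
    exact zero_ne_one heq
  obtain ⟨z, hz, hzr⟩ := spectrum.exists_nnnorm_eq_spectralRadius L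
  rw [heq] at hzr
  refine hev z ?_ (hasEigenvalue_of_mem_spectrum hz (hzr ▸ hess))
  exact congrArg NNReal.toReal (ENNReal.coe_eq_one.1 hzr)

end

/-! ### One-dimensional diffeomorphisms -/

theorem ordConnected_inter_preimage {X Y : Type*} [ConditionallyCompleteLinearOrder X]
    [TopologicalSpace X] [OrderTopology X] [DenselyOrdered X] [LinearOrder Y]
    [TopologicalSpace Y] [OrderClosedTopology Y] {g : X → Y} {s : Set X} {t : Set Y}
    (hs : s.OrdConnected) (ht : t.OrdConnected) (hg : ContinuousOn g s) (hinj : InjOn g s) :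
    (s ∩ g ⁻¹' t).OrdConnected := by
  refine ordConnected_of_Ioo fun x hx y hy hxy r hr => ?_
  have hsub : Icc x y ⊆ s := hs.out hx.1 hy.1
  have hr' : r ∈ Icc x y := Ioo_subset_Icc_self hr
  have hx' : x ∈ Icc x y := left_mem_Icc.2 hxy.le
  have hy' : y ∈ Icc x y := right_mem_Icc.2 hxy.le
  refine ⟨hsub hr', ht.uIcc_subset hx.2 hy.2 ?_⟩
  rcases (hg.mono hsub).strictMonoOn_of_injOn_Icc' hxy.le (hinj.mono hsub) with hmono | hanti
  · exact Icc_subset_uIcc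
      ⟨hmono.monotoneOn hx' hr' hr'.1, hmono.monotoneOn hr' hy' hr'.2⟩
  · exact Icc_subset_uIcc'
      ⟨hanti.antitoneOn hr' hy' hr'.2, hanti.antitoneOn hx' hr' hr'.1⟩

theorem mul_abs_sub_le_abs_image_sub {g : ℝ → ℝ} {s : Set ℝ} {c : ℝ} (hs : s.OrdConnected)
    (hg : ∀ x ∈ s, DifferentiableAt ℝ g x) (hc : ∀ x ∈ s, c ≤ |deriv g x|) {x y : ℝ}
    (hx : x ∈ s) (hy : y ∈ s) : c * |x - y| ≤ |g x - g y| := by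
  wlog hxy : x < y generalizing x y
  · rcases (not_lt.1 hxy).eq_or_lt with rfl | h
    · simp
    · simpa only [abs_sub_comm] using this hy hx h
  have hsub : Icc x y ⊆ s := hs.out hx hy
  obtain ⟨t, ht, hslope⟩ := exists_deriv_eq_slope g hxy
    (fun r hr => (hg r (hsub hr)).continuousAt.continuousWithinAt)
    (fun r hr => (hg r (hsub (Ioo_subset_Icc_self hr))).differentiableWithinAt)
  have hct := hc t (hsub (Ioo_subset_Icc_self ht))
  rwa [hslope, abs_div, le_div_iff₀ (abs_pos.2 (sub_pos.2 hxy).ne'), abs_sub_comm,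
    abs_sub_comm (g y)] at hct

/-- A `C¹` diffeomorphism, with values in `ℝ`, from the open set `s` of the line onto its image.
The inverse is `Function.invFunOn g s`. -/
structure IsDiffeoOn (g : ℝ → ℝ) (s : Set ℝ) : Prop where
  isOpen : IsOpen s
  injOn : InjOn g s
  contDiffAt : ∀ x ∈ s, ContDiffAt ℝ 1 g x
  deriv_ne_zero : ∀ x ∈ s, deriv g x ≠ 0

namespace IsDiffeoOn

variable {g k : ℝ → ℝ} {s t : Set ℝ}

theorem id_univ : IsDiffeoOn id univ where
  isOpen := isOpen_univ
  injOn := injOn_id univ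
  contDiffAt _ _ := contDiffAt_id
  deriv_ne_zero x _ := by simp

theorem differentiableAt (hg : IsDiffeoOn g s) {x : ℝ} (hx : x ∈ s) : DifferentiableAt ℝ g x :=
  (hg.contDiffAt x hx).differentiableAt one_ne_zero

theorem continuousOn (hg : IsDiffeoOn g s) : ContinuousOn g s :=
  fun _ hx => (hg.differentiableAt hx).continuousAt.continuousWithinAt

theorem comp (hk : IsDiffeoOn k t) (hg : IsDiffeoOn g s) :
    IsDiffeoOn (k ∘ g) (s ∩ g ⁻¹' t) where
  isOpen := hg.continuousOn.isOpen_inter_preimage hg.isOpen hk.isOpen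
  injOn := hk.injOn.comp (hg.injOn.mono inter_subset_left) fun _ hx => hx.2
  contDiffAt x hx := (hk.contDiffAt _ hx.2).comp x (hg.contDiffAt x hx.1)
  deriv_ne_zero x hx := by
    rw [deriv_comp x (hk.differentiableAt hx.2) (hg.differentiableAt hx.1)]
    exact mul_ne_zero (hk.deriv_ne_zero _ hx.2) (hg.deriv_ne_zero x hx.1)

theorem isOpen_image_of_subset (hg : IsDiffeoOn g s) (ht : IsOpen t) (hts : t ⊆ s) :
    IsOpen (g '' t) := by
  refine isOpen_iff_mem_nhds.2 ?_
  rintro _ ⟨x, hx, rfl⟩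
  have hstrict := (hg.contDiffAt x (hts hx)).hasStrictDerivAt one_ne_zero
  rw [← hstrict.map_nhds_eq (hg.deriv_ne_zero x (hts hx))]
  exact image_mem_map (ht.mem_nhds hx)

theorem isOpen_image (hg : IsDiffeoOn g s) : IsOpen (g '' s) :=
  hg.isOpen_image_of_subset hg.isOpen Subset.rfl

theorem hasDerivAt_invFunOn (hg : IsDiffeoOn g s) {y : ℝ} (hy : y ∈ g '' s) :
    HasDerivAt (Function.invFunOn g s) (deriv g (Function.invFunOn g s y))⁻¹ y := by
  obtain ⟨x, hx, rfl⟩ := hy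
  have hinv : LeftInvOn (Function.invFunOn g s) g s := hg.injOn.leftInvOn_invFunOn
  rw [hinv hx]
  refine (((hg.contDiffAt x hx).hasStrictDerivAt one_ne_zero).to_local_left_inverse
    (hg.deriv_ne_zero x hx) ?_).hasDerivAt
  filter_upwards [hg.isOpen.mem_nhds hx] with r hr using hinv hr

theorem deriv_invFunOn_ne_zero (hg : IsDiffeoOn g s) {y : ℝ} (hy : y ∈ g '' s) :
    deriv (Function.invFunOn g s) y ≠ 0 := by
  rw [(hg.hasDerivAt_invFunOn hy).deriv]
  exact inv_ne_zero (hg.deriv_ne_zero _ (Function.invFunOn_mem hy))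

theorem continuousOn_invFunOn (hg : IsDiffeoOn g s) :
    ContinuousOn (Function.invFunOn g s) (g '' s) :=
  fun _ hy => (hg.hasDerivAt_invFunOn hy).continuousAt.continuousWithinAt

theorem image_invFunOn_inter (hg : IsDiffeoOn g s) (A : Set ℝ) :
    Function.invFunOn g s '' (g '' s ∩ A) = s ∩ g ⁻¹' A := by
  have hright : LeftInvOn g (Function.invFunOn g s) (g '' s) :=
    fun _ hy => Function.invFunOn_eq hy
  rw [inter_comm, hright.image_inter', hg.injOn.leftInvOn_invFunOn.image_image, inter_comm]

theorem measurableSet_inter_preimage (hg : IsDiffeoOn g s) {A : Set ℝ} (hA : MeasurableSet A) :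
    MeasurableSet (s ∩ g ⁻¹' A) := by
  have h := hg.isOpen.measurableSet.subtype_image (hg.continuousOn.domRestrict.measurable hA)
  rwa [domRestrict_eq, preimage_comp, Subtype.image_preimage_coe] at h

theorem setLIntegral_image_inter (hg : IsDiffeoOn g s) {A : Set ℝ} (hA : MeasurableSet A)
    (F : ℝ → ℝ≥0∞) :
    ∫⁻ y in g '' s ∩ A,
        ‖deriv (Function.invFunOn g s) y‖ₑ * F (Function.invFunOn g s y) =
      ∫⁻ x in s ∩ g ⁻¹' A, F x := by
  have hright : LeftInvOn g (Function.invFunOn g s) (g '' s) :=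
    fun _ hy => Function.invFunOn_eq hy
  simp only [Real.enorm_eq_ofReal_abs]
  rw [← hg.image_invFunOn_inter A]
  exact (lintegral_image_eq_lintegral_abs_deriv_mul
    (hg.isOpen_image.measurableSet.inter hA)
    (fun y hy => (hg.hasDerivAt_invFunOn hy.1).differentiableAt.hasDerivAt.hasDerivWithinAt)
    (hright.injOn.mono inter_subset_left) F).symm

theorem volume_inter_preimage_le (hg : IsDiffeoOn g s) (A : Set ℝ) :
    volume (s ∩ g ⁻¹' A) ≤
      (⨆ y ∈ g '' s, ‖deriv (Function.invFunOn g s) y‖ₑ) * volume A := by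
  set M := ⨆ y ∈ g '' s, ‖deriv (Function.invFunOn g s) y‖ₑ
  calc volume (s ∩ g ⁻¹' A)
      ≤ volume (s ∩ g ⁻¹' toMeasurable volume A) := by
        gcongr; exact subset_toMeasurable volume A
    _ = ∫⁻ y in g '' s ∩ toMeasurable volume A, ‖deriv (Function.invFunOn g s) y‖ₑ := by
        simpa using (hg.setLIntegral_image_inter (measurableSet_toMeasurable volume A) 1).symm
    _ ≤ ∫⁻ _ in g '' s ∩ toMeasurable volume A, M :=
        setLIntegral_mono' (hg.isOpen_image.measurableSet.inter (measurableSet_toMeasurable _ _))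
          fun y hy => le_iSup₂ (f := fun y _ => ‖deriv (Function.invFunOn g s) y‖ₑ) y hy.1
    _ ≤ M * volume A := by
        rw [setLIntegral_const, ← measure_toMeasurable A]
        gcongr
        exact inter_subset_right

theorem volume_inter_preimage_eq_zero (hg : IsDiffeoOn g s) {A : Set ℝ} (hA : volume A = 0) :
    volume (s ∩ g ⁻¹' A) = 0 := by
  rw [← hg.image_invFunOn_inter A]
  exact addHaar_image_eq_zero_of_differentiableOn_of_addHaar_eq_zero volume
    (fun y hy => (hg.hasDerivAt_invFunOn hy.1).differentiableAt.differentiableWithinAt)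
    (measure_mono_null inter_subset_right hA)

theorem volume_image_eq_zero (hg : IsDiffeoOn g s) (hts : t ⊆ s) (ht : volume t = 0) :
    volume (g '' t) = 0 :=
  addHaar_image_eq_zero_of_differentiableOn_of_addHaar_eq_zero volume
    (fun _ hx => (hg.differentiableAt (hts hx)).differentiableWithinAt) ht

end IsDiffeoOn

/-! ### Cylinders and inverse branches -/

section

variable {ι : Type*} {α : ℝ≥0} {f τ : ℝ → ℝ} {O : ι → Set ℝ} {n : ℕ} {w : Fin n → ι}

theorem cylinder_zero (w : Fin 0 → ι) : cylinder f O w = univ := by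
  ext x
  simp [cylinder]

theorem cylinder_succ (w : Fin (n + 1) → ι) :
    cylinder f O w = cylinder f O (Fin.init w) ∩ f^[n] ⁻¹' O (w (Fin.last n)) := by
  ext x
  simp [cylinder, Fin.forall_fin_succ', Fin.init]

theorem cylinder_const (i : ι) : cylinder f O (fun _ : Fin 1 => i) = O i := by
  ext x
  simp [cylinder]

theorem inverseBranch_mem {y : ℝ} (hy : y ∈ branchDomain f O w) :
    inverseBranch f O w y ∈ cylinder f O w :=
  Function.invFunOn_mem hy

theorem iterate_inverseBranch {y : ℝ} (hy : y ∈ branchDomain f O w) :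
    f^[n] (inverseBranch f O w y) = y :=
  Function.invFunOn_eq hy

namespace IsExpandingSkewProduct

variable (hF : IsExpandingSkewProduct α f τ O)
include hF

theorem isOpen (i : ι) : IsOpen (O i) := by
  obtain ⟨a, c, -, -, -, h⟩ := hF.interval i
  exact h ▸ isOpen_Ioo

theorem ordConnected (i : ι) : (O i).OrdConnected := by
  obtain ⟨a, c, -, -, -, h⟩ := hF.interval i
  exact h ▸ ordConnected_Ioo

theorem subset_Ico (i : ι) : O i ⊆ Ico 0 1 := by
  obtain ⟨a, c, h0, -, h1, h⟩ := hF.interval i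
  exact h ▸ (Ioo_subset_Ico_self.trans (Ico_subset_Ico h0 h1))

/-- A factor by which every inverse branch of `f` contracts. -/
def contraction : ℝ := Real.exp (-hF.expanding.choose)

theorem contraction_pos : 0 < hF.contraction := Real.exp_pos _

theorem contraction_lt_one : hF.contraction < 1 :=
  Real.exp_lt_one_iff.2 (neg_lt_zero.2 ((Real.log_pos one_lt_two).trans hF.expanding.choose_spec.1))

theorem inv_contraction_pow_le_abs_deriv {x : ℝ} (hx : x ∈ cylinder f O w) :
    (hF.contraction ^ n)⁻¹ ≤ |deriv f^[n] x| := by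
  rcases Nat.eq_zero_or_pos n with rfl | hn
  · simp
  · rw [contraction, ← Real.exp_nat_mul, ← Real.exp_neg, mul_neg, neg_neg, mul_comm]
    exact hF.expanding.choose_spec.2 n hn w x hx

theorem isDiffeoOn (i : ι) : IsDiffeoOn f (O i) where
  isOpen := hF.isOpen i
  injOn := (hF.monotone i).elim StrictMonoOn.injOn StrictAntiOn.injOn
  contDiffAt _ hx := (hF.contDiffOn i).contDiffAt ((hF.isOpen i).mem_nhds hx)
  deriv_ne_zero x hx := by
    have hexp := hF.inv_contraction_pow_le_abs_deriv (w := fun _ : Fin 1 => i) (x := x)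
      (by rwa [cylinder_const])
    exact abs_pos.1 ((inv_pos.2 (pow_pos hF.contraction_pos 1)).trans_le hexp)

theorem isDiffeoOn_iterate : ∀ {n : ℕ} (w : Fin n → ι), IsDiffeoOn f^[n] (cylinder f O w)
  | 0, w => by rw [cylinder_zero]; exact IsDiffeoOn.id_univ
  | n + 1, w => by
    rw [cylinder_succ, Function.iterate_succ']
    exact (hF.isDiffeoOn _).comp (isDiffeoOn_iterate _)

theorem ordConnected_cylinder : ∀ {n : ℕ} (w : Fin n → ι), (cylinder f O w).OrdConnected
  | 0, w => by rw [cylinder_zero]; exact ordConnected_univ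
  | n + 1, w => by
    have hdiffeo := hF.isDiffeoOn_iterate (Fin.init w)
    rw [cylinder_succ]
    exact ordConnected_inter_preimage (ordConnected_cylinder _) (hF.ordConnected _)
      hdiffeo.continuousOn hdiffeo.injOn

theorem ordConnected_branchDomain (w : Fin n → ι) : (branchDomain f O w).OrdConnected :=
  ((hF.ordConnected_cylinder w).isPreconnected.image _
    (hF.isDiffeoOn_iterate w).continuousOn).ordConnected

theorem inverseBranch_iterate {x : ℝ} (hx : x ∈ cylinder f O w) :
    inverseBranch f O w (f^[n] x) = x :=
  (hF.isDiffeoOn_iterate w).injOn.leftInvOn_invFunOn hx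

theorem differentiableAt_inverseBranch {y : ℝ} (hy : y ∈ branchDomain f O w) :
    DifferentiableAt ℝ (inverseBranch f O w) y :=
  ((hF.isDiffeoOn_iterate w).hasDerivAt_invFunOn hy).differentiableAt

theorem abs_sub_le_contraction_pow_mul {x y : ℝ} (hx : x ∈ cylinder f O w)
    (hy : y ∈ cylinder f O w) : |x - y| ≤ hF.contraction ^ n * |f^[n] x - f^[n] y| := by
  have h := mul_abs_sub_le_abs_image_sub (hF.ordConnected_cylinder w)
    (fun _ => (hF.isDiffeoOn_iterate w).differentiableAt)
    (fun _ => hF.inv_contraction_pow_le_abs_deriv) hx hy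
  rwa [inv_mul_le_iff₀ (pow_pos hF.contraction_pos n)] at h

theorem abs_inverseBranch_sub_le {x y : ℝ} (hx : x ∈ branchDomain f O w)
    (hy : y ∈ branchDomain f O w) :
    |inverseBranch f O w x - inverseBranch f O w y| ≤ hF.contraction ^ n * |x - y| := by
  simpa only [iterate_inverseBranch hx, iterate_inverseBranch hy] using
    hF.abs_sub_le_contraction_pow_mul (inverseBranch_mem hx) (inverseBranch_mem hy)

theorem differentiableAt_fibre {i : ι} {x : ℝ} (hx : x ∈ O i) : DifferentiableAt ℝ τ x :=
  ((hF.contDiffOn_fibre i).contDiffAt ((hF.isOpen i).mem_nhds hx)).differentiableAt one_ne_zero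

theorem differentiableAt_birkhoffSum : ∀ {n : ℕ} {w : Fin n → ι} {x : ℝ},
    x ∈ cylinder f O w → DifferentiableAt ℝ (birkhoffSum f τ n) x
  | 0, _, _, _ => by rw [birkhoffSum_zero']; exact differentiableAt_const 0
  | n + 1, w, x, hx => by
    rw [cylinder_succ] at hx
    have hsum : birkhoffSum f τ (n + 1) = birkhoffSum f τ n + τ ∘ f^[n] :=
      funext fun t => birkhoffSum_succ f τ n t
    rw [hsum]
    exact (differentiableAt_birkhoffSum hx.1).add
      ((hF.differentiableAt_fibre hx.2).comp x
        ((hF.isDiffeoOn_iterate _).differentiableAt hx.1))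

/-- A common Lipschitz constant of the functions `τ_n ∘ h`. -/
def fibreConst : ℝ≥0 := hF.fibre_regularity.choose.toNNReal

theorem lipschitzOnWith_birkhoffSum_inverseBranch (w : Fin n → ι) :
    LipschitzOnWith hF.fibreConst (fun y => birkhoffSum f τ n (inverseBranch f O w y))
      (branchDomain f O w) := by
  rcases Nat.eq_zero_or_pos n with rfl | hn
  · simpa only [birkhoffSum_zero] using (LipschitzWith.const' (0 : ℝ)).lipschitzOnWith
  refine (hF.ordConnected_branchDomain w).convex.lipschitzOnWith_of_nnnorm_deriv_le
    (fun t ht => ?_) (fun t ht => ?_)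
  · exact (hF.differentiableAt_birkhoffSum (inverseBranch_mem ht)).comp t
      (hF.differentiableAt_inverseBranch ht)
  · rw [← NNReal.coe_le_coe, coe_nnnorm]
    exact (hF.fibre_regularity.choose_spec n hn w t ht).trans (Real.le_coe_toNNReal _)

end IsExpandingSkewProduct

end

/-! ### Itineraries of almost every point -/

section

variable {ι : Type*} {α : ℝ≥0} {f τ : ℝ → ℝ} {O : ι → Set ℝ}

/-- The points all of whose iterates stay in the interiors of the partition elements, that is, the
points that have an itinerary. -/
def regularSet (f : ℝ → ℝ) (O : ι → Set ℝ) : Set ℝ := {x | ∀ k : ℕ, ∃ i, f^[k] x ∈ O i}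

theorem exists_mem_cylinder_of_mem_regularSet {x : ℝ} (hx : x ∈ regularSet f O) (n : ℕ) :
    ∃ w : Fin n → ι, x ∈ cylinder f O w := by
  choose i hi using hx
  exact ⟨fun k => i k, fun k => hi k⟩

theorem eventually_cocountable_inf_principal {X : Type*} {s : Set X} {P : X → Prop} :
    (∀ᶠ x in cocountable ⊓ 𝓟 s, P x) ↔ {x ∈ s | ¬ P x}.Countable := by
  rw [eventually_inf_principal, Filter.Eventually, mem_cocountable]
  simp only [compl_ofPred, Classical.not_imp]

namespace IsExpandingSkewProduct

variable [Countable ι] (hF : IsExpandingSkewProduct α f τ O)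
include hF

theorem tendsto_cocountable :
    Tendsto f (cocountable ⊓ 𝓟 (Ico 0 1)) (cocountable ⊓ 𝓟 (Ico 0 1)) := by
  refine tendsto_inf.2 ⟨fun s hs => ?_,
    tendsto_principal.2 (mem_inf_of_right (mem_principal.2 hF.mapsTo))⟩
  change ∀ᶠ x in cocountable ⊓ 𝓟 (Ico (0 : ℝ) 1), f x ∈ s
  rw [eventually_cocountable_inf_principal]
  have hinter (i : ι) : (O i ∩ f ⁻¹' sᶜ).Countable :=
    countable_of_injective_of_countable_image ((hF.isDiffeoOn i).injOn.mono inter_subset_left)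
      ((mem_cocountable.1 hs).mono (image_subset_iff.2 inter_subset_right))
  refine (hF.cover.union (countable_iUnion hinter)).mono fun x ⟨hxI, hxs⟩ => ?_
  by_cases hxO : x ∈ ⋃ i, O i
  · obtain ⟨i, hi⟩ := mem_iUnion.1 hxO
    exact Or.inr (mem_iUnion.2 ⟨i, hi, hxs⟩)
  · exact Or.inl ⟨hxI, hxO⟩

theorem countable_diff_regularSet : (Ico 0 1 \ regularSet f O).Countable := by
  have hiter (k : ℕ) : {x ∈ Ico 0 1 | f^[k] x ∉ ⋃ i, O i}.Countable :=
    eventually_cocountable_inf_principal.1 (hF.tendsto_cocountable.iterate k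
      (eventually_cocountable_inf_principal.2 hF.cover))
  refine (countable_iUnion hiter).mono fun x ⟨hxI, hx⟩ => ?_
  simpa only [regularSet, mem_iUnion, mem_ofPred_eq, not_forall, hxI, true_and] using hx

theorem ae_mem_regularSet : ∀ᵐ x ∂circleMeasure, x ∈ regularSet f O := by
  refine (ae_restrict_iff' measurableSet_Ico).2
    (measure_mono_null (fun x hx => ?_) (hF.countable_diff_regularSet.measure_zero volume))
  simpa [and_assoc] using hx

theorem tendsto_ae : Tendsto f (ae circleMeasure) (ae circleMeasure) := by
  intro s hs
  change ∀ᵐ x ∂circleMeasure, f x ∈ s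
  have hs' : ∀ᵐ y, y ∈ Ico (0 : ℝ) 1 → y ∈ s := (ae_restrict_iff' measurableSet_Ico).1 hs
  have hbranch (i : ι) : ∀ᵐ x, x ∈ O i → f x ∈ s := by
    refine measure_mono_null (fun x hx => ?_)
      ((hF.isDiffeoOn i).volume_inter_preimage_eq_zero (ae_iff.1 hs'))
    obtain ⟨hxi, hxs⟩ : x ∈ O i ∧ f x ∉ s := by simpa using hx
    exact ⟨hxi, fun h => hxs (h (hF.mapsTo (hF.subset_Ico i hxi)))⟩
  filter_upwards [hF.ae_mem_regularSet, ae_restrict_of_ae (ae_all_iff.2 hbranch)] with x hx hxs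
  obtain ⟨i, hi⟩ := hx 0
  exact hxs i hi

end IsExpandingSkewProduct

end

/-! ### Eigenfunctions of the transfer operator -/

theorem sameRay_tsum_of_enorm_tsum_eq {E κ : Type*} [NormedAddCommGroup E] [NormedSpace ℝ E]
    [StrictConvexSpace ℝ E] [CompleteSpace E] {a : κ → E} (h : ‖∑' i, a i‖ₑ = ∑' i, ‖a i‖ₑ)
    (i : κ) : SameRay ℝ (a i) (∑' j, a j) := by
  classical
  have ha : Summable fun j => ‖a j‖ := tsum_enorm_ne_top_iff_summable_norm.1 (h ▸ enorm_ne_top)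
  have hnorm : ‖∑' j, a j‖ = ∑' j, ‖a j‖ := by
    simpa [ENNReal.tsum_toReal_eq] using congrArg ENNReal.toReal h
  have hrest : Summable fun j => ‖if j = i then 0 else a j‖ :=
    ha.of_nonneg_of_le (fun j => norm_nonneg _) fun j => by split_ifs <;> simp
  have hsplit : ∑' j, ‖a j‖ = ‖a i‖ + ∑' j, ‖if j = i then 0 else a j‖ := by
    rw [ha.tsum_eq_add_tsum_ite i]
    simp only [apply_ite norm, norm_zero]
  rw [ha.of_norm.tsum_eq_add_tsum_ite i] at hnorm ⊢
  refine (SameRay.refl _).add_right (sameRay_iff_norm_add.2 (le_antisymm (norm_add_le _ _) ?_))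
  rw [hnorm, hsplit]
  gcongr
  exact norm_tsum_le_tsum_norm hrest

theorem normalize_mul_of_norm_eq_one {z : ℂ} (hz : ‖z‖ = 1) (w : ℂ) :
    NormedSpace.normalize (z * w) = z * NormedSpace.normalize w := by
  simp only [NormedSpace.normalize, norm_mul, hz, one_mul, mul_smul_comm]

theorem norm_exp_I_mul_mul (b t : ℝ) : ‖Complex.exp (Complex.I * b * t)‖ = 1 := by
  rw [mul_assoc, mul_comm, ← Complex.ofReal_mul, Complex.norm_exp_ofReal_mul_I]

/-- The measure `|g| m` on the circle. -/
def densityMeasure (g : ℝ → ℂ) : Measure ℝ := circleMeasure.withDensity fun x => ‖g x‖ₑ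

theorem densityMeasure_absolutelyContinuous (g : ℝ → ℂ) : densityMeasure g ≪ circleMeasure :=
  withDensity_absolutelyContinuous _ _

section

variable {ι : Type*} {α : ℝ≥0} {f τ : ℝ → ℝ} {O : ι → Set ℝ} {b : ℝ} {z : ℂ} {g u : ℝ → ℂ}

/-- The contribution of the inverse branch `h : f(O_i) → O_i` to the transfer operator. -/
def transferTerm (f τ : ℝ → ℝ) (O : ι → Set ℝ) (b : ℝ) (g : ℝ → ℂ) (i : ι) : ℝ → ℂ :=
  (f '' O i).indicator fun y =>
    Complex.exp (Complex.I * b * τ (Function.invFunOn f (O i) y)) *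
      g (Function.invFunOn f (O i) y) * |deriv (Function.invFunOn f (O i)) y|

theorem enorm_transferTerm (i : ι) (y : ℝ) :
    ‖transferTerm f τ O b g i y‖ₑ = (f '' O i).indicator (fun y =>
      ‖deriv (Function.invFunOn f (O i)) y‖ₑ * ‖g (Function.invFunOn f (O i) y)‖ₑ) y := by
  have hexp (t : ℝ) : ‖Complex.exp (Complex.I * b * t)‖ₑ = 1 := by
    rw [← ofReal_norm, norm_exp_I_mul_mul, ENNReal.ofReal_one]
  have habs (t : ℝ) : ‖((|t| : ℝ) : ℂ)‖ₑ = ‖t‖ₑ := by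
    rw [← ofReal_norm, Complex.norm_real, Real.norm_eq_abs, abs_abs, Real.enorm_eq_ofReal_abs]
  rw [transferTerm, enorm_indicator_eq_indicator_enorm]
  simp only [enorm_mul, hexp, habs, one_mul]
  simp only [mul_comm]

/-- The phase `u = g / |g|` of an eigenfunction `g` of the transfer operator, with eigenvalue `z`.
It vanishes where `g` does. -/
structure IsEigenphase (f τ : ℝ → ℝ) (b : ℝ) (z : ℂ) (u : ℝ → ℂ) : Prop where
  measurable : Measurable u
  norm_eq_one : ∀ x, u x ≠ 0 → ‖u x‖ = 1
  exp_mul_eq : ∀ᵐ x ∂circleMeasure, u x ≠ 0 →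
    Complex.exp (Complex.I * b * τ x) * u x = z * u (f x)

namespace IsEigenphase

theorem norm_le_one (hu : IsEigenphase f τ b z u) (x : ℝ) : ‖u x‖ ≤ 1 := by
  by_cases hx : u x = 0
  · simp [hx]
  · exact (hu.norm_eq_one x hx).le

theorem exp_birkhoffSum_mul_eq (hu : IsEigenphase f τ b z u)
    (hf : Tendsto f (ae circleMeasure) (ae circleMeasure)) :
    ∀ᵐ x ∂circleMeasure, ∀ n : ℕ, u x ≠ 0 →
      Complex.exp (Complex.I * b * birkhoffSum f τ n x) * u x = z ^ n * u (f^[n] x) := by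
  filter_upwards [ae_all_iff.2 fun k => (hf.iterate k).eventually hu.exp_mul_eq] with x hx n hx0
  induction n with
  | zero => simp
  | succ n ih =>
    have hn0 : u (f^[n] x) ≠ 0 := fun h => by
      rw [h, mul_zero] at ih
      exact mul_ne_zero (Complex.exp_ne_zero _) hx0 ih
    rw [birkhoffSum_succ, Complex.ofReal_add, mul_add, Complex.exp_add, mul_right_comm, ih,
      mul_assoc, mul_comm (u _), hx n hn0, pow_succ, mul_assoc,
      Function.iterate_succ_apply']

end IsEigenphase

namespace IsExpandingSkewProduct

variable (hF : IsExpandingSkewProduct α f τ O)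
include hF

theorem aemeasurable_enorm_transferTerm (hg : Measurable g) (i : ι) (μ : Measure ℝ) :
    AEMeasurable (fun y => ‖transferTerm f τ O b g i y‖ₑ) μ := by
  have hdiffeo := hF.isDiffeoOn i
  have himage : MeasurableSet (f '' O i) := hdiffeo.isOpen_image.measurableSet
  simp only [enorm_transferTerm]
  refine (aemeasurable_indicator_iff himage).2 ((measurable_deriv _).enorm.aemeasurable.mul ?_)
  exact hg.enorm.comp_aemeasurable (hdiffeo.continuousOn_invFunOn.aemeasurable himage)

theorem setLIntegral_enorm_transferTerm (g : ℝ → ℂ) (i : ι) {A : Set ℝ} (hA : MeasurableSet A) :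
    ∫⁻ y in A, ‖transferTerm f τ O b g i y‖ₑ ∂circleMeasure =
      densityMeasure g (O i ∩ f ⁻¹' A) := by
  have hdiffeo := hF.isDiffeoOn i
  have himage : f '' O i ⊆ Ico 0 1 := (image_mono (hF.subset_Ico i)).trans hF.mapsTo.image_subset
  simp only [enorm_transferTerm]
  rw [lintegral_indicator hdiffeo.isOpen_image.measurableSet,
    Measure.restrict_restrict hdiffeo.isOpen_image.measurableSet, densityMeasure,
    withDensity_apply _ (hdiffeo.measurableSet_inter_preimage hA), circleMeasure,
    Measure.restrict_restrict_of_subset (inter_subset_left.trans himage),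
    Measure.restrict_restrict_of_subset (inter_subset_left.trans (hF.subset_Ico i))]
  exact hdiffeo.setLIntegral_image_inter hA fun x => ‖g x‖ₑ

theorem exp_mul_normalize_eq {i : ι} {x : ℝ} (hz : ‖z‖ = 1) (hx : x ∈ O i) (hgx : g x ≠ 0)
    (hsum : transfer f τ O b g (f x) = z * g (f x))
    (habs : ∑' j, ‖transferTerm f τ O b g j (f x)‖ₑ = ‖g (f x)‖ₑ) :
    Complex.exp (Complex.I * b * τ x) * NormedSpace.normalize (g x) =
      z * NormedSpace.normalize (g (f x)) := by
  have hderiv : 0 < |deriv (Function.invFunOn f (O i)) (f x)| :=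
    abs_pos.2 ((hF.isDiffeoOn i).deriv_invFunOn_ne_zero (mem_image_of_mem f hx))
  have hterm : transferTerm f τ O b g i (f x) = |deriv (Function.invFunOn f (O i)) (f x)| •
      (Complex.exp (Complex.I * b * τ x) * g x) := by
    rw [transferTerm, indicator_of_mem (mem_image_of_mem f hx),
      (hF.isDiffeoOn i).injOn.leftInvOn_invFunOn hx, Complex.real_smul, mul_comm]
  have hterm0 : transferTerm f τ O b g i (f x) ≠ 0 := by
    rw [hterm]
    exact smul_ne_zero hderiv.ne' (mul_ne_zero (Complex.exp_ne_zero _) hgx)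
  have hnorm : ‖transfer f τ O b g (f x)‖ₑ = ‖g (f x)‖ₑ := by
    rw [hsum, enorm_mul, ← ofReal_norm z, hz, ENNReal.ofReal_one, one_mul]
  have htransfer0 : transfer f τ O b g (f x) ≠ 0 := by
    rw [← enorm_ne_zero, hnorm, ← habs]
    exact (ENNReal.tsum_eq_zero.not.2 fun h => enorm_ne_zero.2 hterm0 (h i))
  have hray : SameRay ℝ (transferTerm f τ O b g i (f x)) (transfer f τ O b g (f x)) :=
    sameRay_tsum_of_enorm_tsum_eq (hnorm.trans habs.symm) i
  rw [← normalize_mul_of_norm_eq_one (norm_exp_I_mul_mul b _), ← normalize_mul_of_norm_eq_one hz,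
    ← NormedSpace.normalize_smul_of_pos hderiv, ← hterm, ← hsum]
  exact (sameRay_iff_inv_norm_smul_eq_of_ne hterm0 htransfer0).1 hray

variable [Countable ι]

theorem setLIntegral_tsum_enorm_transferTerm (hg : Measurable g) {A : Set ℝ}
    (hA : MeasurableSet A) :
    ∫⁻ y in A, ∑' i, ‖transferTerm f τ O b g i y‖ₑ ∂circleMeasure =
      densityMeasure g (f ⁻¹' A) := by
  rw [lintegral_tsum fun i => hF.aemeasurable_enorm_transferTerm hg i _]
  simp only [hF.setLIntegral_enorm_transferTerm g _ hA]
  rw [← measure_iUnion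
    (fun i j hij => (hF.disjoint hij).mono inter_subset_left inter_subset_left)
    fun i => (hF.isDiffeoOn i).measurableSet_inter_preimage hA, ← iUnion_inter]
  refine measure_congr ?_
  filter_upwards [(densityMeasure_absolutelyContinuous g).ae_le hF.ae_mem_regularSet] with x hx
  exact propext (and_iff_right (mem_iUnion.2 (hx 0)))

variable (hz : ‖z‖ = 1) (hg : Measurable g) (hgi : ∫⁻ x, ‖g x‖ₑ ∂circleMeasure ≠ ⊤)
  (htr : transfer f τ O b g =ᵐ[circleMeasure] fun x => z * g x)
include hz hg hgi htr

-- The triangle inequality `|g| = |L g| ≤ ∑ |terms|` is between functions of equal integrals.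
theorem tsum_enorm_transferTerm_ae_eq :
    (fun x => ∑' i, ‖transferTerm f τ O b g i x‖ₑ) =ᵐ[circleMeasure] fun x => ‖g x‖ₑ := by
  refine (ae_eq_of_ae_le_of_lintegral_le ?_ hgi (AEMeasurable.tsum fun i =>
    hF.aemeasurable_enorm_transferTerm hg i _) (le_of_eq ?_)).symm
  · filter_upwards [htr] with x hx
    calc ‖g x‖ₑ = ‖transfer f τ O b g x‖ₑ := by
          rw [hx, enorm_mul, ← ofReal_norm z, hz, ENNReal.ofReal_one, one_mul]
      _ ≤ ∑' i, ‖transferTerm f τ O b g i x‖ₑ := enorm_tsum_le_tsum_enorm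
  · rw [← setLIntegral_univ, hF.setLIntegral_tsum_enorm_transferTerm hg .univ, preimage_univ,
      densityMeasure, withDensity_apply _ .univ, setLIntegral_univ]

theorem densityMeasure_preimage {A : Set ℝ} (hA : MeasurableSet A) :
    densityMeasure g (f ⁻¹' A) = densityMeasure g A := by
  rw [← hF.setLIntegral_tsum_enorm_transferTerm (τ := τ) (b := b) hg hA, densityMeasure,
    withDensity_apply _ hA]
  exact lintegral_congr_ae (ae_restrict_of_ae (hF.tsum_enorm_transferTerm_ae_eq hz hg hgi htr))

theorem isEigenphase_normalize : IsEigenphase f τ b z fun x => NormedSpace.normalize (g x) where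
  measurable := hg.norm.inv.smul hg
  norm_eq_one x hx := NormedSpace.norm_normalize (NormedSpace.normalize_eq_zero_iff _ |>.not.1 hx)
  exp_mul_eq := by
    have hsums := htr.and (hF.tsum_enorm_transferTerm_ae_eq hz hg hgi htr)
    filter_upwards [hF.ae_mem_regularSet, hF.tendsto_ae.eventually hsums] with x hx hsum hx0
    obtain ⟨i, hi⟩ : ∃ i, x ∈ O i := hx 0
    exact hF.exp_mul_normalize_eq hz hi (NormedSpace.normalize_eq_zero_iff _ |>.not.1 hx0)
      hsum.1 hsum.2

end IsExpandingSkewProduct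

end

/-! ### Orbits with large images of cylinders -/

theorem volume_setOf_not_ball_subset_le {U : Set ℝ} (hU : U.OrdConnected)
    (hb : Bornology.IsBounded U) (ε : ℝ) :
    volume {y ∈ U | ¬ Metric.ball y ε ⊆ U} ≤ ENNReal.ofReal (2 * ε) := by
  rcases le_or_gt ε 0 with hε | hε
  · simp [Metric.ball_eq_empty.2 hε]
  have hsub : {y ∈ U | ¬ Metric.ball y ε ⊆ U} ⊆
      Icc (sInf U) (sInf U + ε) ∪ Icc (sSup U - ε) (sSup U) := by
    rintro y ⟨hy, hball⟩
    by_contra! hcon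
    simp only [mem_union, mem_Icc, csInf_le hb.bddBelow hy, le_csSup hb.bddAbove hy, true_and,
      and_true, not_or, not_le] at hcon
    refine hball (Subset.trans ?_ (IsConnected.Ioo_csInf_csSup_subset
      ⟨⟨y, hy⟩, hU.isPreconnected⟩ hb.bddBelow hb.bddAbove))
    rw [Real.ball_eq_Ioo]
    exact Ioo_subset_Ioo (by linarith [hcon.1]) (by linarith [hcon.2])
  calc volume {y ∈ U | ¬ Metric.ball y ε ⊆ U}
      ≤ volume (Icc (sInf U) (sInf U + ε)) + volume (Icc (sSup U - ε) (sSup U)) :=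
        (measure_mono hsub).trans (measure_union_le _ _)
    _ = ENNReal.ofReal (2 * ε) := by
        rw [Real.volume_Icc, Real.volume_Icc, add_sub_cancel_left, sub_sub_cancel, two_mul,
          ENNReal.ofReal_add hε.le hε.le]

theorem frequently_ae_frequently_mem {X : Type*} [MeasurableSpace X] {μ : Measure X}
    {s : ℕ → Set X} {c : ℝ≥0∞} (hs : ∀ n, μ (s n)ᶜ ≤ c) (hc : c < μ univ) :
    ∃ᶠ x in ae μ, ∃ᶠ n in atTop, x ∈ s n := by
  intro hcon
  have hmono : Monotone fun N : ℕ => {x | ∀ n ≥ N, x ∉ s n} :=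
    fun N M hNM x hx n hn => hx n (hNM.trans hn)
  have huniv : μ univ ≤ μ (⋃ N : ℕ, {x | ∀ n ≥ N, x ∉ s n}) := by
    refine measure_mono_ae (hcon.mono fun x hx _ => ?_)
    rw [not_frequently, eventually_atTop] at hx
    exact mem_iUnion.2 hx
  rw [hmono.measure_iUnion] at huniv
  exact hc.not_ge (huniv.trans (iSup_le fun N =>
    (measure_mono fun x (hx : ∀ n ≥ N, x ∉ s n) => hx N le_rfl).trans (hs N)))

theorem IsAdapted.densityMeasure_le {α : ℝ≥0} {B : Type*} [NormedAddCommGroup B]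
    [NormedSpace ℂ B] {J : B →ₗ[ℂ] Lp ℂ 1 circleMeasure} (hB : IsAdapted α J) (p : B) {ε : ℝ}
    (hε : 0 < ε) (A : Set ℝ) :
    densityMeasure (J p) A ≤ ENNReal.ofReal (‖p‖ * ε) +
      ENNReal.ofReal (‖p‖ * ε ^ (-(1 + (α : ℝ)⁻¹))) * circleMeasure A := by
  obtain ⟨q, hJq, hq⟩ := hB.approx p ε hε
  set M := ENNReal.ofReal (‖p‖ * ε ^ (-(1 + (α : ℝ)⁻¹)))
  set A' := toMeasurable circleMeasure A
  have hnorm (x : ℝ) : ‖J p x‖ₑ ≤ ‖J p x - q x‖ₑ + M := by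
    calc ‖J p x‖ₑ = ‖(J p x - q x) + q x‖ₑ := by rw [sub_add_cancel]
      _ ≤ ‖J p x - q x‖ₑ + ‖q x‖ₑ := enorm_add_le _ _
      _ ≤ ‖J p x - q x‖ₑ + M := by
        gcongr
        exact (le_iSup (fun y => ‖q y‖ₑ) x).trans (le_add_self.trans hq)
  calc densityMeasure (J p) A ≤ densityMeasure (J p) A' := measure_mono (subset_toMeasurable _ _)
    _ = ∫⁻ x in A', ‖J p x‖ₑ ∂circleMeasure :=
        withDensity_apply _ (measurableSet_toMeasurable _ _)
    _ ≤ ∫⁻ x in A', (‖J p x - q x‖ₑ + M) ∂circleMeasure := lintegral_mono hnorm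
    _ = ∫⁻ x in A', ‖J p x - q x‖ₑ ∂circleMeasure + M * circleMeasure A := by
        rw [lintegral_add_right _ measurable_const, setLIntegral_const, measure_toMeasurable]
    _ ≤ ENNReal.ofReal (‖p‖ * ε) + M * circleMeasure A := by
        gcongr
        exact (setLIntegral_le_lintegral _ _).trans
          (eLpNorm_one_eq_lintegral_enorm.symm.trans_le hJq)

-- Optimizing `IsAdapted.densityMeasure_le` over `ε` leads to `ε = t ^ (2 + α⁻¹)⁻¹`.
theorem IsAdapted.densityMeasure_le_rpow {α : ℝ≥0} {B : Type*} [NormedAddCommGroup B]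
    [NormedSpace ℂ B] {J : B →ₗ[ℂ] Lp ℂ 1 circleMeasure} (hB : IsAdapted α J) (p : B)
    {A : Set ℝ} {s t : ℝ} (hs : 0 ≤ s) (ht : 0 < t)
    (hA : circleMeasure A ≤ ENNReal.ofReal (s * t)) :
    densityMeasure (J p) A ≤ ENNReal.ofReal (‖p‖ * (1 + s) * t ^ (2 + (α : ℝ)⁻¹)⁻¹) := by
  set κ : ℝ := (2 + (α : ℝ)⁻¹)⁻¹
  have hexponent : κ * -(1 + (α : ℝ)⁻¹) + 1 = κ := by
    have : (2 + (α : ℝ)⁻¹) * κ = 1 := mul_inv_cancel₀ (by positivity)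
    linear_combination -this
  have hpow : (t ^ κ) ^ (-(1 + (α : ℝ)⁻¹)) * t = t ^ κ := by
    rw [← Real.rpow_mul ht.le, ← Real.rpow_add_one ht.ne', hexponent]
  calc densityMeasure (J p) A ≤ ENNReal.ofReal (‖p‖ * t ^ κ) +
        ENNReal.ofReal (‖p‖ * (t ^ κ) ^ (-(1 + (α : ℝ)⁻¹))) * circleMeasure A :=
        hB.densityMeasure_le p (Real.rpow_pos_of_pos ht κ) A
    _ ≤ ENNReal.ofReal (‖p‖ * t ^ κ) +
        ENNReal.ofReal (‖p‖ * (t ^ κ) ^ (-(1 + (α : ℝ)⁻¹))) * ENNReal.ofReal (s * t) := by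
        gcongr
    _ = ENNReal.ofReal (‖p‖ * (1 + s) * t ^ κ) := by
        rw [← ENNReal.ofReal_mul (by positivity),
          ← ENNReal.ofReal_add (by positivity) (by positivity)]
        congr 1
        linear_combination (‖p‖ * s) * hpow

section

variable {ι : Type*} {α : ℝ≥0} {f τ : ℝ → ℝ} {O : ι → Set ℝ}

/-- The points whose image is within `ε` of the boundary of the image of their partition
element. -/
def boundaryLayer (f : ℝ → ℝ) (O : ι → Set ℝ) (ε : ℝ) : Set ℝ :=
  ⋃ i, O i ∩ f ⁻¹' {y | ¬ Metric.ball y ε ⊆ f '' O i}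

/-- The points `x` such that the ball of radius `ρ` around `f^n(x)` lies in the image under `f^n`
of the partition element of `f^n` that contains `x`. -/
def largeImageSet (f : ℝ → ℝ) (O : ι → Set ℝ) (n : ℕ) (ρ : ℝ) : Set ℝ :=
  {x | ∃ w : Fin n → ι, x ∈ cylinder f O w ∧ Metric.ball (f^[n] x) ρ ⊆ branchDomain f O w}

theorem measure_preimage_iterate_le {X : Type*} [MeasurableSpace X] {ν : Measure X} {T : X → X}
    (hν : ∀ A, ν (T ⁻¹' A) ≤ ν A) (n : ℕ) (A : Set X) : ν (T^[n] ⁻¹' A) ≤ ν A := by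
  induction n with
  | zero => exact le_rfl
  | succ n ih =>
    rw [Function.iterate_succ, preimage_comp]
    exact (hν _).trans ih

namespace IsExpandingSkewProduct

variable (hF : IsExpandingSkewProduct α f τ O)
include hF

theorem tsum_iSup_deriv_invFunOn_lt_top :
    ∑' i, ⨆ y ∈ f '' O i, ‖deriv (Function.invFunOn f (O i)) y‖ₑ < ⊤ := by
  have hsum := hF.summability 1 le_rfl
  rw [← (Equiv.funUnique (Fin 1) ι).symm.tsum_eq] at hsum
  have hconst (i : ι) : cylinder f O ((Equiv.funUnique (Fin 1) ι).symm i) = O i :=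
    cylinder_const i
  simpa only [branchDomain, inverseBranch, hconst, Function.iterate_one] using hsum

theorem exists_circleMeasure_boundaryLayer_le [Countable ι] :
    ∃ s : ℝ, 0 ≤ s ∧ ∀ ε, circleMeasure (boundaryLayer f O ε) ≤ ENNReal.ofReal (s * ε) := by
  set S := ∑' i, ⨆ y ∈ f '' O i, ‖deriv (Function.invFunOn f (O i)) y‖ₑ
  have hbranch (ε : ℝ) (i : ι) : volume (O i ∩ f ⁻¹' {y | ¬ Metric.ball y ε ⊆ f '' O i}) ≤
      (⨆ y ∈ f '' O i, ‖deriv (Function.invFunOn f (O i)) y‖ₑ) * ENNReal.ofReal (2 * ε) := by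
    have himage : f '' O i ⊆ Ico 0 1 :=
      (image_mono (hF.subset_Ico i)).trans hF.mapsTo.image_subset
    have hordConnected : (f '' O i).OrdConnected :=
      ((hF.ordConnected i).isPreconnected.image f (hF.isDiffeoOn i).continuousOn).ordConnected
    calc volume (O i ∩ f ⁻¹' {y | ¬ Metric.ball y ε ⊆ f '' O i})
        ≤ volume (O i ∩ f ⁻¹' {y ∈ f '' O i | ¬ Metric.ball y ε ⊆ f '' O i}) :=
          measure_mono fun x hx => ⟨hx.1, mem_image_of_mem f hx.1, hx.2⟩
      _ ≤ _ := (hF.isDiffeoOn i).volume_inter_preimage_le _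
      _ ≤ _ := by
        gcongr
        exact volume_setOf_not_ball_subset_le hordConnected
          ((Metric.isBounded_Ico 0 1).subset himage) ε
  refine ⟨2 * S.toReal, by positivity, fun ε => ?_⟩
  calc circleMeasure (boundaryLayer f O ε) ≤ volume (boundaryLayer f O ε) :=
        Measure.restrict_apply_le _ _
    _ ≤ ∑' i, volume (O i ∩ f ⁻¹' {y | ¬ Metric.ball y ε ⊆ f '' O i}) := measure_iUnion_le _
    _ ≤ S * ENNReal.ofReal (2 * ε) :=
        (ENNReal.tsum_le_tsum (hbranch ε)).trans_eq ENNReal.tsum_mul_right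
    _ = ENNReal.ofReal (2 * S.toReal * ε) := by
        rw [← ENNReal.ofReal_toReal (show S ≠ ⊤ from hF.tsum_iSup_deriv_invFunOn_lt_top.ne),
          ← ENNReal.ofReal_mul ENNReal.toReal_nonneg, ENNReal.toReal_ofReal ENNReal.toReal_nonneg]
        congr 1
        ring

theorem mem_largeImageSet_succ {x ρ : ℝ} {n : ℕ} {i : ι} (hi : f^[n] x ∈ O i)
    (hx : x ∈ largeImageSet f O n (hF.contraction * ρ)) (hlayer : f^[n] x ∉ boundaryLayer f O ρ) :
    x ∈ largeImageSet f O (n + 1) ρ := by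
  obtain ⟨w, hxw, hball⟩ := hx
  have hball_i : Metric.ball (f^[n + 1] x) ρ ⊆ f '' O i := by
    rw [Function.iterate_succ_apply']
    by_contra hcon
    exact hlayer (mem_iUnion.2 ⟨i, hi, hcon⟩)
  have hcyl : cylinder f O (Fin.snoc w i : Fin (n + 1) → ι) =
      cylinder f O w ∩ f^[n] ⁻¹' O i := by
    rw [cylinder_succ, Fin.init_snoc, Fin.snoc_last]
  refine ⟨Fin.snoc w i, hcyl ▸ ⟨hxw, hi⟩, fun y hy => ?_⟩
  obtain ⟨y', hy', rfl⟩ := hball_i hy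
  have hy'_ball : y' ∈ Metric.ball (f^[n] x) (hF.contraction * ρ) := by
    have hcontr := hF.abs_sub_le_contraction_pow_mul (w := fun _ : Fin 1 => i) (x := y')
      (y := f^[n] x) (by rwa [cylinder_const]) (by rwa [cylinder_const])
    rw [pow_one, Function.iterate_one, ← Function.iterate_succ_apply' f] at hcontr
    exact hcontr.trans_lt (mul_lt_mul_of_pos_left hy hF.contraction_pos)
  obtain ⟨x', hx', rfl⟩ := hball hy'_ball
  exact ⟨x', hcyl ▸ ⟨hx', hy'⟩, Function.iterate_succ_apply' _ _ _⟩

section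

variable [Countable ι] {ν : Measure ℝ} {κ C : ℝ} (hac : ν ≪ circleMeasure)
  (hν : ∀ A, ν (f ⁻¹' A) ≤ ν A) (hκ : 0 < κ) (hC : 0 ≤ C)
  (hlayer : ∀ t > 0, ν (boundaryLayer f O t) ≤ ENNReal.ofReal (C * t ^ κ))
include hac hν hκ hC hlayer

theorem measure_compl_largeImageSet_le (n : ℕ) {ρ : ℝ} (hρ : 0 < ρ) :
    ν (largeImageSet f O n ρ)ᶜ ≤ ENNReal.ofReal (C * ρ ^ κ / (1 - hF.contraction ^ κ)) := by
  have hcontr : hF.contraction ^ κ < 1 :=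
    Real.rpow_lt_one hF.contraction_pos.le hF.contraction_lt_one hκ
  have hpos : 0 < 1 - hF.contraction ^ κ := sub_pos.2 hcontr
  induction n generalizing ρ with
  | zero =>
    have huniv : largeImageSet f O 0 ρ = univ := eq_univ_of_forall fun x =>
      ⟨Fin.elim0, by simp [cylinder_zero, branchDomain]⟩
    simp [huniv]
  | succ n ih =>
    have hsub : (largeImageSet f O (n + 1) ρ)ᶜ ⊆ (regularSet f O)ᶜ ∪
        ((largeImageSet f O n (hF.contraction * ρ))ᶜ ∪ f^[n] ⁻¹' boundaryLayer f O ρ) := by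
      intro x hx
      by_contra! hcon
      simp only [mem_union, mem_compl_iff, not_or, not_not] at hcon
      obtain ⟨i, hi⟩ := hcon.1 n
      exact hx (hF.mem_largeImageSet_succ hi hcon.2.1 hcon.2.2)
    calc ν (largeImageSet f O (n + 1) ρ)ᶜ
        ≤ 0 + (ν (largeImageSet f O n (hF.contraction * ρ))ᶜ +
            ν (f^[n] ⁻¹' boundaryLayer f O ρ)) := by
          have hregular : ν (regularSet f O)ᶜ = 0 := hac.ae_le hF.ae_mem_regularSet
          rw [← hregular]
          exact (measure_mono hsub).trans ((measure_union_le _ _).trans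
            (add_le_add_right (measure_union_le _ _) _))
      _ ≤ ENNReal.ofReal (C * (hF.contraction * ρ) ^ κ / (1 - hF.contraction ^ κ)) +
            ENNReal.ofReal (C * ρ ^ κ) := by
          rw [zero_add]
          exact add_le_add (ih (mul_pos hF.contraction_pos hρ))
            ((measure_preimage_iterate_le hν n _).trans (hlayer ρ hρ))
      _ = ENNReal.ofReal (C * ρ ^ κ / (1 - hF.contraction ^ κ)) := by
          have hcontr0 := hF.contraction_pos
          rw [← ENNReal.ofReal_add (by positivity) (by positivity),
            Real.mul_rpow hcontr0.le hρ.le]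
          congr 1
          field_simp
          ring

theorem exists_frequently_mem_largeImageSet (hν0 : ν ≠ 0) :
    ∃ ρ > 0, ∃ᶠ x in ae ν, ∃ᶠ n in atTop, x ∈ largeImageSet f O n ρ := by
  have hlim : Tendsto (fun ρ : ℝ => ENNReal.ofReal (C * ρ ^ κ / (1 - hF.contraction ^ κ)))
      (𝓝[>] 0) (𝓝 0) := by
    have hcont : ContinuousAt (fun ρ : ℝ => C * ρ ^ κ / (1 - hF.contraction ^ κ)) 0 :=
      ((Real.continuousAt_rpow_const 0 κ (Or.inr hκ.le)).const_mul C).div_const _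
    have hlim := ENNReal.tendsto_ofReal hcont.tendsto
    rw [Real.zero_rpow hκ.ne', mul_zero, zero_div, ENNReal.ofReal_zero] at hlim
    exact hlim.mono_left nhdsWithin_le_nhds
  obtain ⟨ρ, hsmall, hρ⟩ := ((hlim.eventually_lt_const
    (pos_iff_ne_zero.2 (Measure.measure_univ_ne_zero.2 hν0))).and self_mem_nhdsWithin).exists
  exact ⟨ρ, hρ, frequently_ae_frequently_mem
    (fun n => hF.measure_compl_largeImageSet_le hac hν hκ hC hlayer n hρ) hsmall⟩

end

theorem exists_frequently_mem_largeImageSet_of_isAdapted [Countable ι] {B : Type*}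
    [NormedAddCommGroup B] [NormedSpace ℂ B] {J : B →ₗ[ℂ] Lp ℂ 1 circleMeasure}
    (hB : IsAdapted α J) {p : B}
    (hinv : ∀ A, MeasurableSet A → densityMeasure (J p) (f ⁻¹' A) = densityMeasure (J p) A)
    (hp : densityMeasure (J p) ≠ 0) :
    ∃ ρ > 0, ∃ᶠ x in ae (densityMeasure (J p)), ∃ᶠ n in atTop, x ∈ largeImageSet f O n ρ := by
  obtain ⟨s, hs, hlayer⟩ := hF.exists_circleMeasure_boundaryLayer_le
  refine hF.exists_frequently_mem_largeImageSet (densityMeasure_absolutelyContinuous _)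
    (fun A => ?_) (κ := (2 + (α : ℝ)⁻¹)⁻¹) (C := ‖p‖ * (1 + s)) (by positivity) (by positivity)
    (fun t ht => hB.densityMeasure_le_rpow p hs ht (hlayer t)) hp
  rw [← measure_toMeasurable A, ← hinv _ (measurableSet_toMeasurable _ _)]
  exact measure_mono (preimage_mono (subset_toMeasurable _ _))

end IsExpandingSkewProduct

end

/-! ### Lipschitz phases -/

theorem setLIntegral_ball_comp_le {h : ℝ → ℝ} {y₀ ρ E : ℝ} (hρ : 0 < ρ)
    (hdiff : ∀ y ∈ Metric.ball y₀ ρ, DifferentiableAt ℝ h y) (hinj : InjOn h (Metric.ball y₀ ρ))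
    (hE : ∀ y ∈ Metric.ball y₀ ρ, ∀ y' ∈ Metric.ball y₀ ρ, |deriv h y| ≤ E * |deriv h y'|)
    (h0 : deriv h y₀ ≠ 0) (F : ℝ → ℝ≥0∞) :
    ∫⁻ y in Metric.ball y₀ ρ, F (h y) ≤ ENNReal.ofReal (2 * E ^ 2 * ρ) *
      ⨍⁻ x in Metric.closedBall (h y₀) (E * |deriv h y₀| * ρ), F x ∂volume := by
  have hmem : y₀ ∈ Metric.ball y₀ ρ := Metric.mem_ball_self hρ
  have hs : 0 < |deriv h y₀| := abs_pos.2 h0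
  have hE0 : 0 < E := pos_of_mul_pos_left (hs.trans_le (hE y₀ hmem y₀ hmem)) hs.le
  set s := |deriv h y₀|
  have himage : h '' Metric.ball y₀ ρ ⊆ Metric.closedBall (h y₀) (E * s * ρ) := by
    rintro _ ⟨y, hy, rfl⟩
    have hmvt := (convex_ball y₀ ρ).norm_image_sub_le_of_norm_deriv_le hdiff
      (fun t ht => hE t ht y₀ hmem) hmem hy
    exact hmvt.trans (by gcongr; exact (Metric.mem_ball.1 hy).le)
  have hweight (y : ℝ) (hy : y ∈ Metric.ball y₀ ρ) :
      1 ≤ ENNReal.ofReal (E / s) * ENNReal.ofReal |deriv h y| := by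
    rw [← ENNReal.ofReal_mul (by positivity), ENNReal.one_le_ofReal, div_mul_eq_mul_div,
      one_le_div hs]
    exact hE y₀ hmem y hy
  calc ∫⁻ y in Metric.ball y₀ ρ, F (h y)
      ≤ ∫⁻ y in Metric.ball y₀ ρ,
          ENNReal.ofReal (E / s) * (ENNReal.ofReal |deriv h y| * F (h y)) := by
        refine setLIntegral_mono' measurableSet_ball fun y hy => ?_
        rw [← mul_assoc]
        exact le_mul_of_one_le_left' (hweight y hy)
    _ = ENNReal.ofReal (E / s) * ∫⁻ x in h '' Metric.ball y₀ ρ, F x := by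
        rw [lintegral_const_mul' _ _ ENNReal.ofReal_ne_top,
          lintegral_image_eq_lintegral_abs_deriv_mul measurableSet_ball
            (fun y hy => (hdiff y hy).hasDerivAt.hasDerivWithinAt) hinj]
    _ ≤ ENNReal.ofReal (E / s) * ∫⁻ x in Metric.closedBall (h y₀) (E * s * ρ), F x := by
        gcongr
    _ = ENNReal.ofReal (2 * E ^ 2 * ρ) *
          ⨍⁻ x in Metric.closedBall (h y₀) (E * s * ρ), F x ∂volume := by
        rw [← measure_mul_setLAverage _ measure_closedBall_lt_top.ne, Real.volume_closedBall,
          ← mul_assoc, ← ENNReal.ofReal_mul (by positivity)]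
        congr 2
        field_simp

theorem exists_frequently_ball_subset_ball {X : Type*} [PseudoMetricSpace X] {s : Set X}
    (hs : IsCompact s) {x : ℕ → X} (hx : ∀ n, x n ∈ s) {P : ℕ → Prop} (hP : ∃ᶠ n in atTop, P n)
    {ρ : ℝ} (hρ : 0 < ρ) :
    ∃ y, ∃ᶠ n in atTop, P n ∧ Metric.ball y (ρ / 2) ⊆ Metric.ball (x n) ρ := by
  have : (atTop ⊓ 𝓟 {n | P n}).NeBot := frequently_mem_iff_neBot.1 hP
  obtain ⟨y, -, hy⟩ := hs.exists_mapClusterPt (f := atTop ⊓ 𝓟 {n | P n}) (u := x)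
    (tendsto_principal.2 (Eventually.of_forall hx))
  refine ⟨y, (frequently_inf_principal.1
    (hy.frequently (Metric.ball_mem_nhds y (half_pos hρ)))).mono fun n hn => ⟨hn.1, ?_⟩⟩
  refine Metric.ball_subset_ball' ?_
  have hdist : dist y (x n) < ρ / 2 := Metric.mem_ball'.1 hn.2
  linarith

theorem ae_of_forall_exists_mem_nhds {X : Type*} [TopologicalSpace X] [SecondCountableTopology X]
    [MeasurableSpace X] {μ : Measure X} {s : Set X} {P : X → Prop}
    (h : ∀ x ∈ s, ∃ U ∈ 𝓝 x, ∀ᵐ y ∂μ, y ∈ U → P y) : ∀ᵐ x ∂μ, x ∈ s → P x := by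
  refine measure_null_of_locally_null _ fun x hx => ?_
  obtain ⟨U, hU, hP⟩ := h x (Classical.not_imp.1 hx).1
  refine ⟨_, inter_mem_nhdsWithin _ hU, measure_mono_null ?_ hP⟩
  rintro y ⟨hy, hyU⟩ hPy
  exact (Classical.not_imp.1 hy).2 (hPy hyU)

/-- On `V`, the function `u` agrees almost everywhere with a `K`-Lipschitz function of modulus
one. -/
def IsLipschitzPhaseOn (u : ℝ → ℂ) (K : ℝ≥0) (V : Set ℝ) : Prop :=
  ∃ v : ℝ → ℂ, LipschitzOnWith K v V ∧ (∀ y ∈ V, ‖v y‖ = 1) ∧ ∀ᵐ y, y ∈ V → u y = v y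

namespace IsLipschitzPhaseOn

variable {u : ℝ → ℂ} {K : ℝ≥0} {V : Set ℝ}

theorem mono (hu : IsLipschitzPhaseOn u K V) {U : Set ℝ} (hUV : U ⊆ V) :
    IsLipschitzPhaseOn u K U := by
  obtain ⟨v, hlip, hnorm, hae⟩ := hu
  exact ⟨v, hlip.mono hUV, fun y hy => hnorm y (hUV hy), hae.mono fun y hy hyU => hy (hUV hyU)⟩

theorem of_lipschitzOnWith {G : Set ℝ} (hV : IsOpen V) (hG : ∀ᵐ y, y ∈ V → y ∈ G)
    (hlip : LipschitzOnWith K u G) (hnorm : ∀ y ∈ G, ‖u y‖ = 1) : IsLipschitzPhaseOn u K V := by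
  have hdense : V ⊆ closure G :=
    ((Measure.dense_of_ae hG).open_subset_closure_inter hV).trans
      (closure_mono fun y hy => hy.2 hy.1)
  obtain ⟨v, hv, huv⟩ := hlip.extend_finite_dimension
  refine ⟨v, ?_, fun y hy => ?_, hG.mono fun y hy hyV => huv (hy hyV)⟩
  · refine (LipschitzOnWith.closure hv.continuous.continuousOn fun s hs t ht => ?_).mono hdense
    rw [← huv hs, ← huv ht]
    exact hlip hs ht
  · exact closure_minimal (t := {y | ‖v y‖ = 1})
      (fun t ht => (congrArg norm (huv ht)).symm.trans (hnorm t ht))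
      (isClosed_singleton.preimage hv.continuous.norm) (hdense hy)

variable {v : ℕ → ℝ → ℂ}

theorem of_ae_tendsto (hV : IsOpen V) (hlip : ∀ k, LipschitzOnWith K (v k) V)
    (hnorm : ∀ k, ∀ y ∈ V, ‖v k y‖ = 1)
    (hlim : ∀ᵐ y, y ∈ V → Tendsto (fun k => v k y) atTop (𝓝 (u y))) :
    IsLipschitzPhaseOn u K V := by
  refine of_lipschitzOnWith (G := {y ∈ V | Tendsto (fun k => v k y) atTop (𝓝 (u y))}) hV
    (hlim.mono fun y hy hyV => ⟨hyV, hy hyV⟩) ?_ ?_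
  · refine LipschitzOnWith.of_dist_le_mul fun s hs t ht => ?_
    exact le_of_tendsto (hs.2.dist ht.2)
      (Eventually.of_forall fun k => (hlip k).dist_le_mul s hs.1 t ht.1)
  · rintro y ⟨hyV, hy⟩
    refine tendsto_nhds_unique hy.norm ?_
    simp only [hnorm _ y hyV, tendsto_const_nhds]

theorem of_tendsto_lintegral (hu : Measurable u) (hV : IsOpen V)
    (hlip : ∀ k, LipschitzOnWith K (v k) V) (hnorm : ∀ k, ∀ y ∈ V, ‖v k y‖ = 1)
    (hlim : Tendsto (fun k => ∫⁻ y in V, ‖v k y - u y‖ₑ) atTop (𝓝 0)) :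
    IsLipschitzPhaseOn u K V := by
  simp only [← Pi.sub_apply, ← eLpNorm_one_eq_lintegral_enorm] at hlim
  obtain ⟨ns, -, hns⟩ := (tendstoInMeasure_of_tendsto_eLpNorm one_ne_zero
    (fun k => (hlip k).continuousOn.aestronglyMeasurable hV.measurableSet)
    hu.aestronglyMeasurable hlim).exists_seq_tendsto_ae
  rw [ae_restrict_iff' hV.measurableSet] at hns
  exact of_ae_tendsto hV (fun k => hlip (ns k)) (fun k => hnorm (ns k)) hns

end IsLipschitzPhaseOn

/-- The largest open set that is covered by open sets on which `u` is almost everywhere equal to a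
`K`-Lipschitz function of modulus one. -/
def lipschitzPhaseDomain (u : ℝ → ℂ) (K : ℝ≥0) : Set ℝ :=
  ⋃₀ {U | IsOpen U ∧ IsLipschitzPhaseOn u K U}

theorem isOpen_lipschitzPhaseDomain (u : ℝ → ℂ) (K : ℝ≥0) : IsOpen (lipschitzPhaseDomain u K) :=
  isOpen_sUnion fun _ hU => hU.1

theorem exists_locallyLipschitz_phase (u : ℝ → ℂ) (K : ℝ≥0) :
    ∃ v : ℝ → ℂ, (∀ y ∈ lipschitzPhaseDomain u K, ∃ U ∈ 𝓝 y, LipschitzOnWith K v U) ∧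
      (∀ y ∈ lipschitzPhaseDomain u K, ‖v y‖ = 1) ∧
      ∀ᵐ y, y ∈ lipschitzPhaseDomain u K → u y = v y := by
  have hlocal : ∀ y ∈ lipschitzPhaseDomain u K, ∃ (U : Set ℝ) (v : ℝ → ℂ), IsOpen U ∧ y ∈ U ∧
      U ⊆ lipschitzPhaseDomain u K ∧ LipschitzOnWith K v U ∧ (∀ x ∈ U, ‖v x‖ = 1) ∧
      ∀ᵐ x, x ∈ U → u x = v x := by
    rintro y ⟨U, ⟨hU, hphase⟩, hyU⟩
    have ⟨v, hv⟩ := hphase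
    exact ⟨U, v, hU, hyU, subset_sUnion_of_mem ⟨hU, hphase⟩, hv⟩
  choose! U v hU hyU hUsub hlip hnorm huv using hlocal
  have hglue (y : ℝ) (hy : y ∈ lipschitzPhaseDomain u K) : EqOn (fun x => v x x) (v y) (U y) := by
    intro x hx
    have hxD := hUsub y hy hx
    have hopen := (hU x hxD).inter (hU y hy)
    refine Measure.eqOn_open_of_ae_eq (μ := volume) (f := v x) (g := v y) ?_ hopen
      ((hlip x hxD).continuousOn.mono inter_subset_left)
      ((hlip y hy).continuousOn.mono inter_subset_right) ⟨hyU x hxD, hx⟩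
    rw [EventuallyEq, ae_restrict_iff' hopen.measurableSet]
    filter_upwards [huv x hxD, huv y hy] with t htx hty ht using (htx ht.1).symm.trans (hty ht.2)
  refine ⟨fun x => v x x, fun y hy => ⟨U y, (hU y hy).mem_nhds (hyU y hy), ?_⟩,
    fun y hy => hnorm y hy y (hyU y hy), ae_of_forall_exists_mem_nhds fun y hy =>
      ⟨U y, (hU y hy).mem_nhds (hyU y hy), ?_⟩⟩
  · intro s hs t ht
    rw [hglue y hy hs, hglue y hy ht]
    exact hlip y hy hs ht
  · filter_upwards [huv y hy] with x hx hxU using (hx hxU).trans (hglue y hy hxU).symm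

theorem norm_exp_sub_exp_le (b s t : ℝ) :
    ‖Complex.exp (Complex.I * b * s) - Complex.exp (Complex.I * b * t)‖ ≤ |b| * |s - t| := by
  have hfactor : Complex.exp (Complex.I * b * s) - Complex.exp (Complex.I * b * t) =
      Complex.exp (Complex.I * b * t) *
        (Complex.exp (Complex.I * ((b * (s - t) : ℝ) : ℂ)) - 1) := by
    rw [mul_sub, ← Complex.exp_add, mul_one]
    congr 2
    push_cast
    ring
  rw [hfactor, norm_mul, norm_exp_I_mul_mul, one_mul, ← abs_mul]
  exact Real.norm_exp_I_mul_ofReal_sub_one_le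

section

variable {ι : Type*} {α : ℝ≥0} {f τ : ℝ → ℝ} {O : ι → Set ℝ} {b : ℝ} {z : ℂ} {n : ℕ}
  {w : Fin n → ι}

/-- The transport of `v` by the inverse branch `h` of `f^n` under `u ∘ f^n = z^{-n} e^{ibτ_n} u`. -/
def transport (f τ : ℝ → ℝ) (O : ι → Set ℝ) (b : ℝ) (z : ℂ) (w : Fin n → ι) (v : ℝ → ℂ) (y : ℝ) :
    ℂ :=
  (z ^ n)⁻¹ * (Complex.exp (Complex.I * b * birkhoffSum f τ n (inverseBranch f O w y)) *
    v (inverseBranch f O w y))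

theorem norm_transport (hz : ‖z‖ = 1) (v : ℝ → ℂ) (y : ℝ) :
    ‖transport f τ O b z w v y‖ = ‖v (inverseBranch f O w y)‖ := by
  rw [transport, norm_mul, norm_mul, norm_inv, norm_pow, hz, one_pow, inv_one, one_mul,
    norm_exp_I_mul_mul, one_mul]

theorem transport_sub (v v' : ℝ → ℂ) (y : ℝ) :
    transport f τ O b z w v y - transport f τ O b z w v' y =
      transport f τ O b z w (v - v') y := by
  simp only [transport, Pi.sub_apply, mul_sub]

namespace IsExpandingSkewProduct

variable (hF : IsExpandingSkewProduct α f τ O)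
include hF

theorem cylinder_subset_Ico (hn : 1 ≤ n) (w : Fin n → ι) : cylinder f O w ⊆ Ico 0 1 :=
  fun _ hx => hF.subset_Ico _ (hx ⟨0, hn⟩)

theorem branchDomain_subset_Ico (hn : 1 ≤ n) (w : Fin n → ι) : branchDomain f O w ⊆ Ico 0 1 :=
  (image_mono (hF.cylinder_subset_Ico hn w)).trans (hF.mapsTo.iterate n).image_subset

theorem abs_deriv_inverseBranch_le {y : ℝ} (hy : y ∈ branchDomain f O w) :
    |deriv (inverseBranch f O w) y| ≤ hF.contraction ^ n := by
  rw [inverseBranch, ((hF.isDiffeoOn_iterate w).hasDerivAt_invFunOn hy).deriv, abs_inv]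
  exact inv_le_of_inv_le₀ (pow_pos hF.contraction_pos n)
    (hF.inv_contraction_pow_le_abs_deriv (inverseBranch_mem hy))

/-- A bound for the distortion of the inverse branches of all iterates of `f`. -/
def distortionConst : ℝ := Real.exp hF.distortion.choose

theorem abs_deriv_inverseBranch_le_mul (hn : 1 ≤ n) {x y : ℝ} (hx : x ∈ branchDomain f O w)
    (hy : y ∈ branchDomain f O w) : |deriv (inverseBranch f O w) x| ≤
      hF.distortionConst * |deriv (inverseBranch f O w) y| := by
  obtain ⟨hD, hdist⟩ := hF.distortion.choose_spec
  have habs : |x - y| ≤ 1 := Real.dist_le_of_mem_Icc_01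
    (Ico_subset_Icc_self (hF.branchDomain_subset_Ico hn w hx))
    (Ico_subset_Icc_self (hF.branchDomain_subset_Ico hn w hy))
  refine (div_le_iff₀ (abs_pos.2 ((hF.isDiffeoOn_iterate w).deriv_invFunOn_ne_zero hy))).1 ?_
  exact (hdist n hn w x hx y hy).trans (Real.exp_le_exp.2
    (mul_le_of_le_one_right hD (Real.rpow_le_one (abs_nonneg _) habs α.2)))

theorem setLIntegral_inverseBranch_le (hn : 1 ≤ n) {x ρ : ℝ} (hx : x ∈ cylinder f O w)
    (hρ : 0 < ρ) (hball : Metric.ball (f^[n] x) ρ ⊆ branchDomain f O w) (F : ℝ → ℝ≥0∞) :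
    ∫⁻ y in Metric.ball (f^[n] x) ρ, F (inverseBranch f O w y) ≤
      ENNReal.ofReal (2 * hF.distortionConst ^ 2 * ρ) *
        ⨍⁻ y in Metric.closedBall x
          (hF.distortionConst * |deriv (inverseBranch f O w) (f^[n] x)| * ρ), F y ∂volume := by
  have hchange := setLIntegral_ball_comp_le (h := inverseBranch f O w) hρ
    (fun y hy => hF.differentiableAt_inverseBranch (hball hy))
    (fun y hy y' hy' heq => by
      rw [← iterate_inverseBranch (hball hy), heq, iterate_inverseBranch (hball hy')])
    (fun y hy y' hy' => hF.abs_deriv_inverseBranch_le_mul hn (hball hy) (hball hy'))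
    ((hF.isDiffeoOn_iterate w).deriv_invFunOn_ne_zero (mem_image_of_mem _ hx)) F
  rwa [hF.inverseBranch_iterate hx] at hchange

theorem lipschitzOnWith_transport (hz : ‖z‖ = 1) {v : ℝ → ℂ} {K : ℝ≥0} {U V : Set ℝ}
    (hlip : LipschitzOnWith K v U) (hnorm : ∀ x ∈ U, ‖v x‖ = 1) (hV : V ⊆ branchDomain f O w)
    (hVU : MapsTo (inverseBranch f O w) V U) :
    LipschitzOnWith (K + ‖b‖₊ * hF.fibreConst) (transport f τ O b z w v) V := by
  refine LipschitzOnWith.of_dist_le_mul fun s hs t ht => ?_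
  have hv : ‖v (inverseBranch f O w s) - v (inverseBranch f O w t)‖ ≤ K * |s - t| := by
    refine ((hlip.norm_sub_le (hVU hs) (hVU ht)).trans ?_)
    gcongr
    exact (hF.abs_inverseBranch_sub_le (hV hs) (hV ht)).trans (mul_le_of_le_one_left
      (abs_nonneg _) (pow_le_one₀ hF.contraction_pos.le hF.contraction_lt_one.le))
  have hexp := (norm_exp_sub_exp_le b _ _).trans (mul_le_mul_of_nonneg_left
    ((hF.lipschitzOnWith_birkhoffSum_inverseBranch w).norm_sub_le (hV hs) (hV ht)) (abs_nonneg b))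
  rw [dist_eq_norm, transport, transport, ← mul_sub, norm_mul, norm_inv, norm_pow, hz, one_pow,
    inv_one, one_mul]
  set e : ℝ → ℂ := fun y =>
    Complex.exp (Complex.I * b * birkhoffSum f τ n (inverseBranch f O w y))
  calc ‖e s * v (inverseBranch f O w s) - e t * v (inverseBranch f O w t)‖
      = ‖e s * (v (inverseBranch f O w s) - v (inverseBranch f O w t)) +
          (e s - e t) * v (inverseBranch f O w t)‖ := by
        congr 1
        ring
    _ ≤ K * |s - t| + |b| * (hF.fibreConst * |s - t|) := by
        refine (norm_add_le _ _).trans (add_le_add ?_ ?_)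
        · rwa [norm_mul, norm_exp_I_mul_mul, one_mul]
        · rwa [norm_mul, hnorm _ (hVU ht), mul_one]
    _ = (K + ‖b‖₊ * hF.fibreConst : ℝ≥0) * dist s t := by
        rw [Real.dist_eq, NNReal.coe_add, NNReal.coe_mul, coe_nnnorm, Real.norm_eq_abs]
        ring

end IsExpandingSkewProduct

end

section

variable {ι : Type*} {α : ℝ≥0} {f τ : ℝ → ℝ} {O : ι → Set ℝ} {b : ℝ} {z : ℂ} {u : ℝ → ℂ}
  {n : ℕ} {w : Fin n → ι}

theorem IsDiffeoOn.ae_invFunOn {g : ℝ → ℝ} {s : Set ℝ} (hg : IsDiffeoOn g s) {P : ℝ → Prop}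
    (h : ∀ᵐ x, P x) : ∀ᵐ y, y ∈ g '' s → P (Function.invFunOn g s y) := by
  refine measure_mono_null (fun y hy => ?_)
    (hg.volume_image_eq_zero inter_subset_left (measure_mono_null inter_subset_right h))
  obtain ⟨hys, hP⟩ := Classical.not_imp.1 hy
  exact ⟨_, ⟨Function.invFunOn_mem hys, hP⟩, Function.invFunOn_eq hys⟩

namespace IsExpandingSkewProduct

variable (hF : IsExpandingSkewProduct α f τ O)
include hF

theorem tendsto_contraction_pow : Tendsto (fun n => hF.contraction ^ n) atTop (𝓝 0) :=
  tendsto_pow_atTop_nhds_zero_of_lt_one hF.contraction_pos.le hF.contraction_lt_one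

theorem distortionConst_pos : 0 < hF.distortionConst := Real.exp_pos _

theorem tendsto_mul_abs_deriv_inverseBranch {φ : ℕ → ℕ} (hφ : Tendsto φ atTop atTop) {x ρ : ℝ}
    {w : ∀ k, Fin (φ k) → ι} (hw : ∀ k, x ∈ cylinder f O (w k)) (hρ : 0 < ρ) :
    Tendsto (fun k => hF.distortionConst * |deriv (inverseBranch f O (w k)) (f^[φ k] x)| * ρ)
      atTop (𝓝[>] 0) := by
  have hmem (k : ℕ) : f^[φ k] x ∈ branchDomain f O (w k) := mem_image_of_mem _ (hw k)
  have hE := hF.distortionConst_pos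
  have hpos (k : ℕ) : 0 < |deriv (inverseBranch f O (w k)) (f^[φ k] x)| :=
    abs_pos.2 ((hF.isDiffeoOn_iterate (w k)).deriv_invFunOn_ne_zero (hmem k))
  have hlim : Tendsto (fun k => hF.distortionConst * hF.contraction ^ φ k * ρ) atTop (𝓝 0) := by
    simpa using ((hF.tendsto_contraction_pow.comp hφ).const_mul hF.distortionConst).mul_const ρ
  refine tendsto_nhdsWithin_iff.2 ⟨squeeze_zero (fun k => by positivity) (fun k => ?_) hlim,
    Eventually.of_forall fun k => mul_pos (mul_pos hE (hpos k)) hρ⟩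
  gcongr
  exact hF.abs_deriv_inverseBranch_le (hmem k)

theorem exists_cylinder_subset [Countable ι] {V : Set ℝ} (hV : IsOpen V) (hVne : V.Nonempty)
    (hVI : V ⊆ Ico 0 1) :
    ∃ n, 1 ≤ n ∧ ∃ w : Fin n → ι, (cylinder f O w).Nonempty ∧ cylinder f O w ⊆ V := by
  obtain ⟨x, hxreg, hxV⟩ : (regularSet f O ∩ V).Nonempty := by
    by_contra hempty
    have hsub : V ⊆ Ico 0 1 \ regularSet f O := fun x hx => ⟨hVI hx, fun h => hempty ⟨x, h, hx⟩⟩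
    exact (hV.measure_pos volume hVne).ne'
      (measure_mono_null hsub (hF.countable_diff_regularSet.measure_zero volume))
  obtain ⟨ε, hε, hball⟩ := Metric.isOpen_iff.1 hV x hxV
  obtain ⟨n, hn, hnε⟩ := ((eventually_ge_atTop 1).and
    (hF.tendsto_contraction_pow.eventually (gt_mem_nhds hε))).exists
  obtain ⟨w, hw⟩ := exists_mem_cylinder_of_mem_regularSet hxreg n
  refine ⟨n, hn, w, ⟨x, hw⟩, fun y hy => hball ?_⟩
  have hdist : |f^[n] y - f^[n] x| ≤ 1 := Real.dist_le_of_mem_Icc_01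
    (Ico_subset_Icc_self (hF.mapsTo.iterate n (hF.cylinder_subset_Ico hn w hy)))
    (Ico_subset_Icc_self (hF.mapsTo.iterate n (hVI hxV)))
  rw [Metric.mem_ball, Real.dist_eq]
  exact ((hF.abs_sub_le_contraction_pow_mul hy hw).trans (mul_le_of_le_one_right
    (pow_pos hF.contraction_pos n).le hdist)).trans_lt hnε

end IsExpandingSkewProduct

namespace IsEigenphase

variable (hu : IsEigenphase f τ b z u) [Countable ι] (hF : IsExpandingSkewProduct α f τ O)
include hu hF

theorem ae_eq_transport (hz : ‖z‖ = 1) (w : Fin n → ι) :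
    ∀ᵐ y, y ∈ branchDomain f O w → inverseBranch f O w y ∈ Ico 0 1 →
      u (inverseBranch f O w y) ≠ 0 → u y = transport f τ O b z w u y := by
  have hz0 : z ^ n ≠ 0 := pow_ne_zero n (norm_ne_zero_iff.1 (hz.trans_ne one_ne_zero))
  have heq := (ae_restrict_iff' measurableSet_Ico).1 (hu.exp_birkhoffSum_mul_eq hF.tendsto_ae)
  filter_upwards [(hF.isDiffeoOn_iterate w).ae_invFunOn heq] with y hy hyw hyI hy0
  rw [transport, inverseBranch, hy hyw hyI n hy0, inv_mul_cancel_left₀ hz0]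
  exact congrArg u (iterate_inverseBranch hyw).symm

theorem ae_norm_transport_const_sub_le (hz : ‖z‖ = 1) (hn : 1 ≤ n) {c : ℂ} (hc : ‖c‖ = 1)
    (w : Fin n → ι) : ∀ᵐ y, y ∈ branchDomain f O w →
      ‖transport f τ O b z w (fun _ => c) y - u y‖ ≤ 2 * ‖u (inverseBranch f O w y) - c‖ := by
  filter_upwards [hu.ae_eq_transport hF hz w] with y hy hyw
  by_cases h0 : u (inverseBranch f O w y) = 0
  · rw [h0, zero_sub, norm_neg, hc]
    refine (norm_sub_le _ _).trans ?_
    rw [norm_transport hz, hc]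
    linarith [hu.norm_le_one y]
  · rw [hy hyw (hF.cylinder_subset_Ico hn w (inverseBranch_mem hyw)) h0, transport_sub,
      norm_transport hz, Pi.sub_apply, norm_sub_rev]
    linarith [norm_nonneg (u (inverseBranch f O w y) - c)]

theorem setLIntegral_transport_const_sub_le (hz : ‖z‖ = 1) (hn : 1 ≤ n) {c : ℂ} (hc : ‖c‖ = 1)
    {x ρ : ℝ} (hx : x ∈ cylinder f O w) (hρ : 0 < ρ)
    (hball : Metric.ball (f^[n] x) ρ ⊆ branchDomain f O w) :
    ∫⁻ y in Metric.ball (f^[n] x) ρ, ‖transport f τ O b z w (fun _ => c) y - u y‖ₑ ≤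
      2 * (ENNReal.ofReal (2 * hF.distortionConst ^ 2 * ρ) *
        ⨍⁻ y in Metric.closedBall x
          (hF.distortionConst * |deriv (inverseBranch f O w) (f^[n] x)| * ρ),
          ‖u y - c‖ₑ ∂volume) := by
  refine le_trans ?_ (mul_le_mul_right (hF.setLIntegral_inverseBranch_le hn hx hρ hball _) 2)
  rw [← lintegral_const_mul' _ _ ENNReal.ofNat_ne_top]
  refine setLIntegral_mono_ae' measurableSet_ball ?_
  filter_upwards [hu.ae_norm_transport_const_sub_le hF hz hn hc w] with y hy hyball
  have hle := ENNReal.ofReal_le_ofReal (hy (hball hyball))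
  rwa [ENNReal.ofReal_mul zero_le_two, ofReal_norm, ofReal_norm, ENNReal.ofReal_ofNat] at hle

/-- At a Lebesgue point `x` of `u`, the transports of the constant `u x` converge to `u` along the
times at which the images of the cylinders around `x` are large. -/
theorem exists_isLipschitzPhaseOn (hz : ‖z‖ = 1) {x ρ : ℝ} (hxI : x ∈ Ico 0 1) (hx : u x ≠ 0)
    (hρ : 0 < ρ) (hlarge : ∃ᶠ n in atTop, x ∈ largeImageSet f O n ρ)
    (hleb : Tendsto (fun δ => ⨍⁻ y in Metric.closedBall x δ, ‖u y - u x‖ₑ ∂volume) (𝓝[>] 0)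
      (𝓝 0)) :
    ∃ V, IsOpen V ∧ V.Nonempty ∧ V ⊆ Ico 0 1 ∧ IsLipschitzPhaseOn u (‖b‖₊ * hF.fibreConst) V := by
  obtain ⟨y₀, hfreq⟩ := exists_frequently_ball_subset_ball isCompact_Icc
    (fun n => Ico_subset_Icc_self (hF.mapsTo.iterate n hxI))
    (hlarge.and_eventually (eventually_ge_atTop 1)) hρ
  obtain ⟨φ, hφ, hφlarge⟩ := extraction_of_frequently_atTop hfreq
  choose w hw hball using fun k => (hφlarge k).1.1
  have hn (k : ℕ) : 1 ≤ φ k := (hφlarge k).1.2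
  have hV (k : ℕ) : Metric.ball y₀ (ρ / 2) ⊆ branchDomain f O (w k) :=
    (hφlarge k).2.trans (hball k)
  have hc : ‖u x‖ = 1 := hu.norm_eq_one x hx
  refine ⟨Metric.ball y₀ (ρ / 2), Metric.isOpen_ball, ⟨y₀, Metric.mem_ball_self (half_pos hρ)⟩,
    (hV 0).trans (hF.branchDomain_subset_Ico (hn 0) _),
    .of_tendsto_lintegral (v := fun k => transport f τ O b z (w k) fun _ => u x) hu.measurable
      Metric.isOpen_ball (fun k => ?_) (fun k y _ => (norm_transport hz _ y).trans hc) ?_⟩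
  · simpa only [zero_add] using hF.lipschitzOnWith_transport (U := univ) hz
      (LipschitzWith.const (u x)).lipschitzOnWith (fun _ _ => hc) (hV k) (mapsTo_univ _ _)
  · have hδ := hF.tendsto_mul_abs_deriv_inverseBranch hφ.tendsto_atTop hw hρ
    have hlim := ENNReal.Tendsto.const_mul (a := 2) (ENNReal.Tendsto.const_mul
      (a := ENNReal.ofReal (2 * hF.distortionConst ^ 2 * ρ)) (hleb.comp hδ)
      (Or.inr ENNReal.ofReal_ne_top)) (Or.inr ENNReal.ofNat_ne_top)
    rw [mul_zero, mul_zero] at hlim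
    exact tendsto_of_tendsto_of_tendsto_of_le_of_le tendsto_const_nhds hlim
      (fun _ => zero_le) fun k => (lintegral_mono_set (hφlarge k).2).trans
        (hu.setLIntegral_transport_const_sub_le hF hz (hn k) hc (hw k) hρ (hball k))

theorem isLipschitzPhaseOn_image (hz : ‖z‖ = 1) {K : ℝ≥0} {U : Set ℝ}
    (hU : IsLipschitzPhaseOn u K U) (hUw : U ⊆ cylinder f O w) (hUI : U ⊆ Ico 0 1) :
    IsLipschitzPhaseOn u (K + ‖b‖₊ * hF.fibreConst) (f^[n] '' U) := by
  obtain ⟨v, hlip, hnorm, huv⟩ := hU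
  have hdom : f^[n] '' U ⊆ branchDomain f O w := image_mono hUw
  have hmaps : MapsTo (inverseBranch f O w) (f^[n] '' U) U := by
    rintro _ ⟨x, hx, rfl⟩
    rwa [hF.inverseBranch_iterate (hUw hx)]
  refine ⟨transport f τ O b z w v, hF.lipschitzOnWith_transport hz hlip hnorm hdom hmaps,
    fun y hy => (norm_transport hz v y).trans (hnorm _ (hmaps hy)), ?_⟩
  filter_upwards [hu.ae_eq_transport hF hz w, (hF.isDiffeoOn_iterate w).ae_invFunOn huv]
    with y hy hyv hyU
  have hv : u (inverseBranch f O w y) = v (inverseBranch f O w y) := hyv (hdom hyU) (hmaps hyU)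
  have h0 : u (inverseBranch f O w y) ≠ 0 :=
    norm_ne_zero_iff.1 (hv ▸ (hnorm _ (hmaps hyU)).trans_ne one_ne_zero)
  rw [hy (hdom hyU) (hUI (hmaps hyU)) h0, transport, transport, hv]

/-- By the covering property, the images of a small cylinder fill the circle. -/
theorem ae_mem_lipschitzPhaseDomain (hz : ‖z‖ = 1) {K : ℝ≥0} {V : Set ℝ}
    (hK : IsLipschitzPhaseOn u K V) (hV : IsOpen V) (hVne : V.Nonempty) (hVI : V ⊆ Ico 0 1) :
    ∀ᵐ y ∂circleMeasure, y ∈ lipschitzPhaseDomain u (K + ‖b‖₊ * hF.fibreConst) := by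
  obtain ⟨n, hn, w, hwne, hwV⟩ := hF.exists_cylinder_subset hV hVne hVI
  obtain ⟨N, hN⟩ := hF.covering n hn
  rw [circleMeasure, ae_restrict_iff' measurableSet_Ico]
  filter_upwards [(hN w hwne).ae_notMem volume,
    (hF.countable_diff_regularSet.image f^[N]).ae_notMem volume] with y hyw hyreg hyI
  obtain ⟨x, hx, rfl⟩ : y ∈ f^[N] '' cylinder f O w := not_not.1 fun h => hyw ⟨hyI, h⟩
  have hxreg : x ∈ regularSet f O :=
    not_not.1 fun h => hyreg ⟨x, ⟨hVI (hwV hx), h⟩, rfl⟩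
  obtain ⟨w', hxw'⟩ := exists_mem_cylinder_of_mem_regularSet hxreg N
  have hopen : IsOpen (cylinder f O w ∩ cylinder f O w') :=
    (hF.isDiffeoOn_iterate w).isOpen.inter (hF.isDiffeoOn_iterate w').isOpen
  exact ⟨f^[N] '' (cylinder f O w ∩ cylinder f O w'),
    ⟨(hF.isDiffeoOn_iterate w').isOpen_image_of_subset hopen inter_subset_right,
      hu.isLipschitzPhaseOn_image hF hz (hK.mono (inter_subset_left.trans hwV)) inter_subset_right
        (inter_subset_left.trans (hwV.trans hVI))⟩,
    mem_image_of_mem _ ⟨hx, hxw'⟩⟩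

end IsEigenphase

end

/-! ### The cohomological equation -/

theorem exists_lipschitzWith_ae_hasDerivAt {ω : ℝ → ℝ} {K : ℝ≥0}
    (hω : AEStronglyMeasurable ω volume) (hK : ∀ x, ‖ω x‖ ≤ K) :
    ∃ φ : ℝ → ℝ, LipschitzWith K φ ∧ ∀ᵐ x, HasDerivAt φ (ω x) x := by
  have hloc : LocallyIntegrable ω volume := (locallyIntegrable_const (K : ℝ)).mono hω
    (Eventually.of_forall fun x => (hK x).trans (Real.le_norm_self _))
  have hint (s t : ℝ) : IntervalIntegrable ω volume s t :=
    (hloc.integrableOn_isCompact isCompact_uIcc).intervalIntegrable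
  refine ⟨fun x => ∫ t in 0..x, ω t, LipschitzWith.of_dist_le_mul fun x y => ?_,
    (LocallyIntegrable.ae_hasDerivAt_integral hloc).mono fun x hx => hx 0⟩
  rw [dist_eq_norm, intervalIntegral.integral_interval_sub_left (hint _ _) (hint _ _), Real.dist_eq]
  exact intervalIntegral.norm_integral_le_of_norm_le_const fun t _ => hK t

theorem exists_lipschitzWith_hasDerivAt_im_logDeriv {v : ℝ → ℂ} {K : ℝ≥0} {s : Set ℝ}
    (hs : IsOpen s) (hlip : ∀ y ∈ s, ∃ U ∈ 𝓝 y, LipschitzOnWith K v U)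
    (hnorm : ∀ y ∈ s, ‖v y‖ = 1) :
    ∃ φ : ℝ → ℝ, LipschitzWith K φ ∧
      ∀ᵐ y, y ∈ s → DifferentiableAt ℝ v y ∧ HasDerivAt φ (logDeriv v y).im y := by
  have hcont : ContinuousOn v s := fun y hy => have ⟨_, hU, hlipU⟩ := hlip y hy
    (hlipU.continuousOn.continuousAt hU).continuousWithinAt
  have hmeas : AEStronglyMeasurable (s.indicator fun y => (logDeriv v y).im) volume := by
    refine (aestronglyMeasurable_indicator_iff hs.measurableSet).2
      (AEMeasurable.aestronglyMeasurable ?_)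
    exact Complex.measurable_im.comp_aemeasurable
      ((measurable_deriv v).aemeasurable.div (hcont.aemeasurable hs.measurableSet))
  obtain ⟨φ, hφ, hderiv⟩ := exists_lipschitzWith_ae_hasDerivAt (K := K) hmeas fun y => by
    refine (norm_indicator_eq_indicator_norm _ _).trans_le (indicator_apply_le' (fun hy => ?_)
      fun _ => K.2)
    obtain ⟨U, hU, hlipU⟩ := hlip y hy
    refine (Complex.abs_im_le_norm _).trans ?_
    rw [logDeriv_apply, norm_div, hnorm y hy, div_one]
    exact norm_deriv_le_of_lipschitzOn hU hlipU
  have hdiff : ∀ᵐ y, y ∈ s → DifferentiableAt ℝ v y := ae_of_forall_exists_mem_nhds fun y hy => by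
    obtain ⟨U, hU, hlipU⟩ := hlip y hy
    refine ⟨interior U, interior_mem_nhds.2 hU, ?_⟩
    filter_upwards [hlipU.ae_differentiableWithinAt_of_mem (μ := volume)] with x hx hxU
      using (hx (interior_subset hxU)).differentiableAt (mem_interior_iff_mem_nhds.1 hxU)
  refine ⟨φ, hφ, ?_⟩
  filter_upwards [hderiv, hdiff] with y hyφ hyv hy
  rw [indicator_of_mem hy] at hyφ
  exact ⟨hyv hy, hyφ⟩

section

variable {ι : Type*} {α : ℝ≥0} {f τ : ℝ → ℝ} {O : ι → Set ℝ} {b : ℝ} {z : ℂ} {u v : ℝ → ℂ}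

theorem im_logDeriv_comp_mul_eq {x f' τ' : ℝ} (hz : z ≠ 0) (hf : HasDerivAt f f' x)
    (hτ : HasDerivAt τ τ' x) (hv : DifferentiableAt ℝ v x) (hvf : DifferentiableAt ℝ v (f x))
    (hvx : v x ≠ 0)
    (h : (fun t => Complex.exp (Complex.I * b * τ t) * v t) =ᶠ[𝓝 x] fun t => z * v (f t)) :
    (logDeriv v (f x)).im * f' = b * τ' + (logDeriv v x).im := by
  have hexp : HasDerivAt (fun t => Complex.exp (Complex.I * b * τ t))
      (Complex.exp (Complex.I * b * τ x) * (Complex.I * b * τ')) x :=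
    (hτ.ofReal_comp.const_mul (Complex.I * b)).cexp
  have hlog := (logDeriv_congr_nhds h).self_of_nhds
  rw [logDeriv_mul x (Complex.exp_ne_zero _) hvx hexp.differentiableAt hv,
    logDeriv_const_mul x z hz, logDeriv_apply, hexp.deriv,
    mul_div_cancel_left₀ _ (Complex.exp_ne_zero _), logDeriv_apply (fun t => v (f t)),
    HasDerivAt.deriv (f := fun t => v (f t)) (hvf.hasDerivAt.scomp x hf), Complex.real_smul,
    mul_div_assoc, ← logDeriv_apply] at hlog
  have him := congrArg Complex.im hlog
  rw [Complex.im_ofReal_mul, Complex.add_im, mul_assoc, ← Complex.ofReal_mul, Complex.I_mul_im,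
    Complex.ofReal_re] at him
  linarith

namespace IsExpandingSkewProduct

variable (hF : IsExpandingSkewProduct α f τ O)
include hF

theorem eqOn_const_of_ae_hasDerivAt_zero {φ : ℝ → ℝ} {K : ℝ≥0} (hφ : LipschitzWith K φ) (i : ι)
    (h : ∀ᵐ x, x ∈ O i → HasDerivAt (τ - φ ∘ f + φ) 0 x) :
    ∃ c, EqOn (τ - φ ∘ f + φ) (fun _ => c) (O i) := by
  obtain ⟨a, d, -, had, -, hO⟩ := hF.interval i
  obtain ⟨x₀, hx₀⟩ : (O i).Nonempty := by rw [hO]; exact nonempty_Ioo.2 had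
  refine ⟨(τ - φ ∘ f + φ) x₀, fun x hx => ?_⟩
  have hsub : uIcc x₀ x ⊆ O i := (hF.ordConnected i).uIcc_subset hx₀ hx
  obtain ⟨Kτ, hτ⟩ := ((hF.contDiffOn_fibre i).mono hsub).exists_lipschitzOnWith one_ne_zero
    (convex_uIcc _ _) isCompact_uIcc
  obtain ⟨Kf, hf⟩ := ((hF.contDiffOn i).mono hsub).exists_lipschitzOnWith one_ne_zero
    (convex_uIcc _ _) isCompact_uIcc
  have hac : AbsolutelyContinuousOnInterval (τ - φ ∘ f + φ) x₀ x :=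
    (hτ.absolutelyContinuousOnInterval.sub
      (hφ.comp_lipschitzOnWith hf).absolutelyContinuousOnInterval).add
      hφ.lipschitzOnWith.absolutelyContinuousOnInterval
  obtain ⟨c, hc⟩ := hac.const_of_ae_hasDerivAt_zero (h.mono fun t ht htx => ht (hsub htx))
  exact (hc x right_mem_uIcc).trans (hc x₀ left_mem_uIcc).symm

theorem eventuallyEq_of_ae_eq {s : Set ℝ} (hs : IsOpen s) (hv : ContinuousOn v s) {i : ι} {x : ℝ}
    (h : ∀ᵐ t, t ∈ O i → Complex.exp (Complex.I * b * τ t) * v t = z * v (f t)) (hx : x ∈ O i)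
    (hxs : x ∈ s) (hfxs : f x ∈ s) :
    (fun t => Complex.exp (Complex.I * b * τ t) * v t) =ᶠ[𝓝 x] fun t => z * v (f t) := by
  have hf : ContinuousOn f (O i) := (hF.contDiffOn i).continuousOn
  have hopen : IsOpen ((O i ∩ f ⁻¹' s) ∩ s) :=
    (hf.isOpen_inter_preimage (hF.isOpen i) hs).inter hs
  refine (Measure.eqOn_open_of_ae_eq (μ := volume) ?_ hopen ?_ ?_).eventuallyEq_of_mem
    (hopen.mem_nhds ⟨⟨hx, hfxs⟩, hxs⟩)
  · rw [EventuallyEq, ae_restrict_iff' hopen.measurableSet]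
    filter_upwards [h] with t ht hts using ht hts.1.1
  · refine ContinuousOn.mul ?_ (hv.mono inter_subset_right)
    refine Complex.continuous_exp.comp_continuousOn (continuousOn_const.mul ?_)
    exact Complex.continuous_ofReal.comp_continuousOn
      ((hF.contDiffOn_fibre i).continuousOn.mono fun t ht => ht.1.1)
  · exact continuousOn_const.mul (hv.comp (hf.mono fun t ht => ht.1.1) fun t ht => ht.1.2)

variable [Countable ι]

theorem exists_lipschitzWith_ae_hasDerivAt_zero {K : ℝ≥0} {s : Set ℝ} (hb : b ≠ 0) (hz : z ≠ 0)
    (hs : IsOpen s) (hmem : ∀ᵐ x ∂circleMeasure, x ∈ s)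
    (hlip : ∀ y ∈ s, ∃ U ∈ 𝓝 y, LipschitzOnWith K v U) (hnorm : ∀ y ∈ s, ‖v y‖ = 1)
    (hv : ∀ᵐ x ∂circleMeasure, Complex.exp (Complex.I * b * τ x) * v x = z * v (f x)) :
    ∃ φ : ℝ → ℝ, LipschitzWith (‖b⁻¹‖₊ * K) φ ∧
      ∀ i, ∀ᵐ x, x ∈ O i → HasDerivAt (τ - φ ∘ f + φ) 0 x := by
  have hcont : ContinuousOn v s := fun y hy => have ⟨_, hU, hlipU⟩ := hlip y hy
    (hlipU.continuousOn.continuousAt hU).continuousWithinAt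
  obtain ⟨θ, hθ, hderiv⟩ := exists_lipschitzWith_hasDerivAt_im_logDeriv hs hlip hnorm
  have hgood : ∀ᵐ x ∂circleMeasure, x ∈ s ∧ DifferentiableAt ℝ v x ∧
      HasDerivAt θ (logDeriv v x).im x := by
    filter_upwards [hmem, ae_restrict_of_ae hderiv] with x hx hxd using ⟨hx, hxd hx⟩
  have hgood' := hF.tendsto_ae.eventually hgood
  rw [circleMeasure, ae_restrict_iff' measurableSet_Ico] at hv hgood hgood'
  refine ⟨fun x => b⁻¹ * θ x, (lipschitzWith_smul b⁻¹).comp hθ, fun i => ?_⟩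
  filter_upwards [hgood, hgood'] with x hx hfx hxi
  obtain ⟨hxs, hvx, hθx⟩ := hx (hF.subset_Ico i hxi)
  obtain ⟨hfxs, hvfx, hθfx⟩ := hfx (hF.subset_Ico i hxi)
  have hf := ((hF.isDiffeoOn i).differentiableAt hxi).hasDerivAt
  have hτ := (hF.differentiableAt_fibre hxi).hasDerivAt
  have hkey := im_logDeriv_comp_mul_eq hz hf hτ hvx hvfx
    (norm_ne_zero_iff.1 ((hnorm x hxs).trans_ne one_ne_zero))
    (hF.eventuallyEq_of_ae_eq hs hcont (hv.mono fun t ht hti => ht (hF.subset_Ico i hti)) hxi hxs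
      hfxs)
  refine ((hτ.sub ((hθfx.const_mul b⁻¹).comp x hf)).add (hθx.const_mul b⁻¹)).congr_deriv ?_
  rw [mul_assoc, hkey]
  field_simp
  ring

end IsExpandingSkewProduct

theorem IsEigenphase.exists_cohomologous [Countable ι] (hu : IsEigenphase f τ b z u)
    (hF : IsExpandingSkewProduct α f τ O) {K : ℝ≥0} (hb : b ≠ 0) (hz : z ≠ 0)
    (hmem : ∀ᵐ y ∂circleMeasure, y ∈ lipschitzPhaseDomain u K) :
    ∃ φ : ℝ → ℝ, (∃ K : ℝ≥0, LipschitzOnWith K φ (Ico 0 1)) ∧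
      ∀ i, ∃ c : ℝ, ∀ x ∈ O i, τ x = φ (f x) - φ x + c := by
  obtain ⟨v, hlip, hnorm, huv⟩ := exists_locallyLipschitz_phase u K
  have hphase : ∀ᵐ x ∂circleMeasure, u x = v x ∧ u x ≠ 0 := by
    filter_upwards [hmem, ae_restrict_of_ae huv] with x hx hxuv
    exact ⟨hxuv hx, norm_ne_zero_iff.1 (hxuv hx ▸ (hnorm x hx).trans_ne one_ne_zero)⟩
  have hv : ∀ᵐ x ∂circleMeasure, Complex.exp (Complex.I * b * τ x) * v x = z * v (f x) := by
    filter_upwards [hphase, hF.tendsto_ae.eventually hphase, hu.exp_mul_eq] with x hx hfx heq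
    rw [← hx.1, ← hfx.1, heq hx.2]
  obtain ⟨φ, hφ, hderiv⟩ := hF.exists_lipschitzWith_ae_hasDerivAt_zero hb hz
    (isOpen_lipschitzPhaseDomain u K) hmem hlip hnorm hv
  refine ⟨φ, ⟨_, hφ.lipschitzOnWith⟩, fun i => ?_⟩
  obtain ⟨c, hc⟩ := hF.eqOn_const_of_ae_hasDerivAt_zero hφ i (hderiv i)
  refine ⟨c, fun x hx => ?_⟩
  have hcx : τ x - φ (f x) + φ x = c := hc hx
  linarith

end

/-! ### Eigenvalues of modulus one -/

theorem ae_tendsto_setLAverage_enorm_sub {E : Type*} [NormedAddCommGroup E] {u : ℝ → E}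
    (hu : LocallyIntegrable u volume) :
    ∀ᵐ x, Tendsto (fun δ => ⨍⁻ y in Metric.closedBall x δ, ‖u y - u x‖ₑ ∂volume) (𝓝[>] 0)
      (𝓝 0) := by
  filter_upwards [(Besicovitch.vitaliFamily volume).ae_tendsto_lintegral_enorm_sub_div hu] with x hx
  simpa only [setLAverage_eq, Function.comp_def] using
    hx.comp (Besicovitch.tendsto_filterAt volume x)

section

variable {ι : Type*} {α : ℝ≥0} {f τ : ℝ → ℝ} {O : ι → Set ℝ} {b : ℝ} {z : ℂ} {u : ℝ → ℂ}

theorem IsEigenphase.locallyIntegrable (hu : IsEigenphase f τ b z u) :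
    LocallyIntegrable u volume :=
  (locallyIntegrable_const (1 : ℝ)).mono hu.measurable.aestronglyMeasurable
    (Eventually.of_forall fun x => (hu.norm_le_one x).trans (Real.le_norm_self 1))

theorem IsEigenphase.false_of_frequently_mem_largeImageSet [Countable ι]
    (hu : IsEigenphase f τ b z u) (hF : IsExpandingSkewProduct α f τ O) (hb : b ≠ 0)
    (hz : ‖z‖ = 1) {ν : Measure ℝ} (hν : ν ≪ circleMeasure) (hu0 : ∀ᵐ x ∂ν, u x ≠ 0) {ρ : ℝ}
    (hρ : 0 < ρ) (hlarge : ∃ᶠ x in ae ν, ∃ᶠ n in atTop, x ∈ largeImageSet f O n ρ) : False := by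
  have hleb := hν.ae_le ((ae_restrict_mem measurableSet_Ico).and
    (ae_restrict_of_ae (ae_tendsto_setLAverage_enorm_sub hu.locallyIntegrable)))
  obtain ⟨x, hx, hx0, hxI, hxleb⟩ := (hlarge.and_eventually (hu0.and hleb)).exists
  obtain ⟨V, hV, hVne, hVI, hphase⟩ := hu.exists_isLipschitzPhaseOn hF hz hxI hx0 hρ hx hxleb
  exact hF.not_cohomologous (hu.exists_cohomologous hF hb
    (norm_ne_zero_iff.1 (hz.trans_ne one_ne_zero))
    (hu.ae_mem_lipschitzPhaseDomain hF hz hphase hV hVne hVI))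

theorem ae_densityMeasure_ne_zero {g : ℝ → ℂ} (hg : Measurable g) :
    ∀ᵐ x ∂densityMeasure g, g x ≠ 0 :=
  (ae_withDensity_iff hg.enorm).2 (Eventually.of_forall fun _ => enorm_ne_zero.1)

theorem densityMeasure_coeFn_ne_zero {g : Lp ℂ 1 circleMeasure} (hg : g ≠ 0) :
    densityMeasure g ≠ 0 := by
  rw [densityMeasure, Ne,
    withDensity_eq_zero_iff (Lp.stronglyMeasurable g).measurable.enorm.aemeasurable]
  refine fun h => hg ((Lp.eq_zero_iff_ae_eq_zero).2 ?_)
  filter_upwards [h] with x hx using enorm_eq_zero.1 hx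

variable {B : Type*} [NormedAddCommGroup B] [NormedSpace ℂ B] {J : B →ₗ[ℂ] Lp ℂ 1 circleMeasure}
  {L : B →L[ℂ] B}

theorem IsTransferOn.transfer_ae_eq (hL : IsTransferOn f τ O b J L) {p : B} (hp : L p = z • p) :
    transfer f τ O b (J p) =ᵐ[circleMeasure] fun x => z * J p x := by
  have hLp := hL p
  rw [hp, map_smul] at hLp
  exact hLp.symm.trans (Lp.coeFn_smul z (J p))

theorem IsTransferOn.not_hasEigenvalue [Countable ι] (hL : IsTransferOn f τ O b J L)
    (hF : IsExpandingSkewProduct α f τ O) (hB : IsAdapted α J) (hb : b ≠ 0) (hz : ‖z‖ = 1) :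
    ¬ Module.End.HasEigenvalue (L : B →ₗ[ℂ] B) z := by
  intro hev
  obtain ⟨p, hp⟩ := hev.exists_hasEigenvector
  have hg : Measurable (J p) := (Lp.stronglyMeasurable (J p)).measurable
  have hgi : ∫⁻ x, ‖J p x‖ₑ ∂circleMeasure ≠ ⊤ := by
    rw [← eLpNorm_one_eq_lintegral_enorm]
    exact (Lp.eLpNorm_lt_top (J p)).ne
  have htr := hL.transfer_ae_eq hp.apply_eq_smul
  obtain ⟨ρ, hρ, hlarge⟩ := hF.exists_frequently_mem_largeImageSet_of_isAdapted hB
    (fun _ => hF.densityMeasure_preimage hz hg hgi htr)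
    (densityMeasure_coeFn_ne_zero ((map_ne_zero_iff J hB.injective).2 hp.2))
  refine (hF.isEigenphase_normalize hz hg hgi htr).false_of_frequently_mem_largeImageSet hF hb hz
    (densityMeasure_absolutelyContinuous _) ?_ hρ hlarge
  exact (ae_densityMeasure_ne_zero hg).mono fun _ => (NormedSpace.normalize_eq_zero_iff _).not.2

end

end SkewProduct

end


theorem mainTheorem3_general {ι : Type*} [Countable ι] (α : ℝ≥0) (f τ : ℝ → ℝ) (O : ι → Set ℝ)
    (hF : SkewProduct.IsExpandingSkewProduct α f τ O) {B : Type*} [NormedAddCommGroup B]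
    [NormedSpace ℂ B] [CompleteSpace B] (J : B →ₗ[ℂ] Lp ℂ 1 SkewProduct.circleMeasure)
    (hB : SkewProduct.IsAdapted α J) :
    ∀ b : ℝ, b ≠ 0 → ∀ L : B →L[ℂ] B, SkewProduct.IsTransferOn f τ O b J L →
      spectralRadius ℂ L ≤ 1 → SkewProduct.essentialSpectralRadius L < 1 →
      ∃ C r : ℝ, 0 < r ∧ ∀ n : ℕ, ‖L ^ n‖ ≤ C * Real.exp (-r * n) :=
  fun _ hb _ hL hrad hess =>
    SkewProduct.exists_norm_pow_le_exp_of_forall_not_hasEigenvalue hrad hess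
      fun _ hz => hL.not_hasEigenvalue hF hB hb hz

theorem mainTheorem3 {ι : Type*} [Countable ι] (α : ℝ≥0) (hα : 0 < α) (hα1 : α ≤ 1)
    (f τ : ℝ → ℝ) (O : ι → Set ℝ) (hF : SkewProduct.IsExpandingSkewProduct α f τ O)
    {B : Type*} [NormedAddCommGroup B] [NormedSpace ℂ B] [CompleteSpace B]
    (J : B →ₗ[ℂ] Lp ℂ 1 SkewProduct.circleMeasure) (hB : SkewProduct.IsAdapted α J)
    (μ : Measure ℝ) (hμ : SkewProduct.IsMixingInvariant f J μ) :
    ∀ b : ℝ, b ≠ 0 → ∀ L : B →L[ℂ] B, SkewProduct.IsTransferOn f τ O b J L →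
      spectralRadius ℂ L ≤ 1 → SkewProduct.essentialSpectralRadius L < 1 →
      ∃ C r : ℝ, 0 < r ∧ ∀ n : ℕ, ‖L ^ n‖ ≤ C * Real.exp (-r * n) :=
  mainTheorem3_general α f τ O hF J hB
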